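/- **Conventions.** $2^\omega$ is the Cantor space, $2^{<\omega}$ the set of finite binary sequences, $|s|$ the length of $s$, and concatenation is written by juxtaposition. Put $\langle n,p\rangle:=\big(\sum_{k\le n+p}k\big)+p$, a bijection $\omega^2\to\omega$, and let $q\mapsto((q)_0,(q)_1)$ be its inverse. For Polish spaces $X,Y$ and a Borel class $\Gamma$, a set $A\subseteq X\times Y$ is in $\mathrm{pot}(\Gamma)$ if there are finer Polish topologies $\sigma$ on $X$ and $\tau$ on $Y$ with $A\in\Gamma([X,\sigma]\times[Y,\tau])$. A set $E\subseteq\bigcup_{q\in\omega}2^q\times2^q$ is a *test* if - (a) for every $q\in\omega$ there is exactly one pair $(s_q,t_q)\in E\cap(2^q\times2^q)$; - (b) for all $m,p\in\omega$ and $u\in2^{<\omega}$ there is $v\in2^{<\omega}$ with $(s_p0uv,t_p1uv)\in E$ and $(|t_p1uv|-1)_0=m$; - (c) for every $n>0$ there are $q<n$ and $w\in2^{<\omega}$ with $s_n=s_q0w$ and $t_n=t_q1w$. The *tree generated by $E$* is $T:=\{(\emptyset,\emptyset)\}\cup\{(s_q0w,t_q1w)\mid q\in\omega,\ w\in2^{<\omega}\}$,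 and $[T]\subseteq2^\omega\times2^\omega$ is its set of infinite branches. A tree $T$ on $2\times2$ *has acyclic levels* if for every $p\in\omega$ the bipartite graph on the disjoint sum $2^p\oplus2^p$, whose edges join $s$ in the first copy to $t$ in the second copy for $(s,t)\in T\cap(2^p\times2^p)$, is acyclic. Define $\rho_0:2^\omega\to2^\omega$ by $\rho_0(\varepsilon)(i)=1$ if $\varepsilon(\langle i,j\rangle)=0$ for all $j\in\omega$, and $\rho_0(\varepsilon)(i)=0$ otherwise. For each countable limit ordinal $\lambda>0$ fix a sequence $(\xi^\lambda_k)_{k\in\omega}$ of ordinals with $0<\xi^\lambda_k<\lambda$ and $\sum_k\xi^\lambda_k=\lambda$ (such sequences exist). For $\xi<\omega_1$ define $\rho_0^\xi:2^\omega\to2^\omega$ by $\rho_0^0=\mathrm{Id}$, $\rho_0^{\eta+1}=\rho_0\circ\rho_0^\eta$, and, for $\lambda>0$ limit, $\rho_0^\lambda(\varepsilon)(k)=\big(\rho_0^{(k,k+1)}\circ\cdots\circ\rho_0^{(0,1)}\big)(\varepsilon)(k)$, where $\rho_0^{(k,k+1)}(\varepsilon)(i)=\varepsilon(i)$ if $i<k$,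 and $\rho_0^{(k,k+1)}(\varepsilon)(i)=\rho_0^{\xi^\lambda_k}\big(j\mapsto\varepsilon(j+k)\big)(i-k)$ if $i\ge k$. Put $H_{1+\xi}:=(\rho_0^\xi)^{-1}(\{0^\infty\})$. Let $\mathcal S(\alpha)(m):=\alpha(m+1)$, let $\alpha\Delta\beta\in2^\omega$ be given by $(\alpha\Delta\beta)(m)=1\Leftrightarrow\alpha(m)\ne\beta(m)$, and, for the tree $T$ generated by a test, put $$S_{1+\xi}:=\{(\alpha,\beta)\in[T]\mid\mathcal S(\alpha\Delta\beta)\notin H_{1+\xi}\}.$$ **Theorem 1.11.** There exists a test. Let $T$ be the tree generated by any test. Then $T$ is a tree with acyclic levels and, for every $\xi<\omega_1$ (and any choice of the sequences $(\xi^\lambda_k)$): 1. $S_{1+\xi}$ is a $\mathbf\Sigma^0_{1+\xi}$ subset of the space $[T]$; 2. $[T]\setminus S_{1+\xi}$ is a $\mathbf\Pi^0_{1+\xi}$ subset of $2^\omega\times2^\omega$; 3. $[T]\setminus S_{1+\xi}$ is not $\mathrm{pot}(\mathbf\Sigma^0_{1+\xi})$; 4. $S_{1+\xi}$ is not $\mathrm{pot}(\mathbf\Pi^0_{1+\xi})$.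 -/

import Mathlib

open Set Order

noncomputable section

/-! ### The Borel hierarchy and potential classes -/

/-- The additive Borel classes `Σ⁰_ξ`, for ordinals `ξ ≥ 1`, of a topological space: `Σ⁰_1` consists
of the open sets, and for `ξ > 1` the members of `Σ⁰_ξ` are the countable unions of sets `A n` whose
complements are in `Σ⁰_{η n}` (i.e. `A n` is in `Π⁰_{η n}`) for some `1 ≤ η n < ξ`. -/
inductive IsSigma0 {X : Type*} [TopologicalSpace X] : Ordinal.{0} → Set X → Prop
  | of_isOpen {A : Set X} (hA : IsOpen A) : IsSigma0 1 A
  | iUnion {ξ : Ordinal.{0}} (hξ : 1 < ξ) (A : ℕ → Set X) (η : ℕ → Ordinal.{0})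
      (hη : ∀ n, 1 ≤ η n ∧ η n < ξ) (hA : ∀ n, IsSigma0 (η n) (A n)ᶜ) : IsSigma0 ξ (⋃ n, A n)

/-- The multiplicative Borel classes `Π⁰_ξ`, for `ξ ≥ 1`. -/
def IsPi0 {X : Type*} [TopologicalSpace X] (ξ : Ordinal.{0}) (A : Set X) : Prop :=
  IsSigma0 ξ Aᶜ

/-- `A ∈ pot(Σ⁰_ξ)`: there are finer Polish topologies `σ` on `X` and `τ` on `Y` such that `A` is
`Σ⁰_ξ` in `[X, σ] × [Y, τ]`. -/
def IsPotSigma0 {X Y : Type*} [tX : TopologicalSpace X] [tY : TopologicalSpace Y]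
    (ξ : Ordinal.{0}) (A : Set (X × Y)) : Prop :=
  ∃ (σ : TopologicalSpace X) (τ : TopologicalSpace Y), σ ≤ tX ∧ τ ≤ tY ∧
    @PolishSpace X σ ∧ @PolishSpace Y τ ∧
    @IsSigma0 (X × Y) (@instTopologicalSpaceProd X Y σ τ) ξ A

/-- `A ∈ pot(Π⁰_ξ)`: there are finer Polish topologies `σ` on `X` and `τ` on `Y` such that `A` is
`Π⁰_ξ` in `[X, σ] × [Y, τ]`. -/
def IsPotPi0 {X Y : Type*} [tX : TopologicalSpace X] [tY : TopologicalSpace Y]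
    (ξ : Ordinal.{0}) (A : Set (X × Y)) : Prop :=
  ∃ (σ : TopologicalSpace X) (τ : TopologicalSpace Y), σ ≤ tX ∧ τ ≤ tY ∧
    @PolishSpace X σ ∧ @PolishSpace Y τ ∧
    @IsPi0 (X × Y) (@instTopologicalSpaceProd X Y σ τ) ξ A

/-! ### Trees on `2 × 2` with acyclic levels -/

/-- The Cantor space `2^ω`, with the product topology; `false` is `0` and `true` is `1`. -/
abbrev Cantor : Type := ℕ → Bool

/-- A tree on `2 × 2`, seen as a set of pairs of finite binary sequences of the same length which
is closed under taking initial segments. -/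
def IsBinaryPairTree (T : Set (List Bool × List Bool)) : Prop :=
  (∀ x ∈ T, x.1.length = x.2.length) ∧ ∀ x ∈ T, ∀ n : ℕ, (x.1.take n, x.2.take n) ∈ T

/-- The bipartite graph on the sum `F₀ ⊕ F₁` whose edges are the `{f₀, f₁}` with `(f₀, f₁) ∈ R`. -/
def bipartiteGraphOf {F₀ F₁ : Type*} (R : Set (F₀ × F₁)) : SimpleGraph (F₀ ⊕ F₁) :=
  SimpleGraph.fromRel fun x y => ∃ f₀ f₁, (f₀, f₁) ∈ R ∧ x = Sum.inl f₀ ∧ y = Sum.inr f₁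

/-- The level `T ∩ (2^p × 2^p)`. -/
def levelOf (T : Set (List Bool × List Bool)) (p : ℕ) :
    Set (List.Vector Bool p × List.Vector Bool p) :=
  {x | (x.1.toList, x.2.toList) ∈ T}

/-- `T` is a tree with acyclic levels. -/
def IsTreeWithAcyclicLevels (T : Set (List Bool × List Bool)) : Prop :=
  IsBinaryPairTree T ∧ ∀ p : ℕ, (bipartiteGraphOf (levelOf T p)).IsAcyclic

/-- The initial segment of length `n` of `α`. -/
def initSeg (α : Cantor) (n : ℕ) : List Bool :=
  List.ofFn fun i : Fin n => α i

/-- The set `[T]` of infinite branches of `T`. -/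
def branches (T : Set (List Bool × List Bool)) : Set (Cantor × Cantor) :=
  {x | ∀ n : ℕ, (initSeg x.1 n, initSeg x.2 n) ∈ T}

/-! ### Tests -/

/-- The pairing function `⟨n, p⟩ = (∑_{k ≤ n + p} k) + p`. -/
def pairing (n p : ℕ) : ℕ :=
  (∑ k ∈ Finset.range (n + p + 1), k) + p

/-- `M(q)`, the largest `m` with `∑_{k ≤ m} k ≤ q` (such an `m` is at most `q`). -/
def diagonalIndex (q : ℕ) : ℕ :=
  Nat.findGreatest (fun m => ∑ k ∈ Finset.range (m + 1), k ≤ q) q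

/-- `(q)₀ = M(q) - (q - ∑_{k ≤ M(q)} k)`, the first coordinate of the inverse of `pairing`. -/
def firstCoord (q : ℕ) : ℕ :=
  diagonalIndex q - (q - ∑ k ∈ Finset.range (diagonalIndex q + 1), k)

/-- `E ⊆ ⋃_q 2^q × 2^q` is a test. -/
structure IsTest (E : Set (List Bool × List Bool)) : Prop where
  length_eq : ∀ x ∈ E, x.1.length = x.2.length
  /-- For each `q` there is a unique pair `(s_q, t_q)` in `E ∩ (2^q × 2^q)`. -/
  existsUnique : ∀ q : ℕ, ∃! x : List Bool × List Bool, x ∈ E ∧ x.1.length = q ∧ x.2.length = q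
  /-- For all `m`, all `(s_p, t_p)` and all `u` there is `v` with `(s_p 0 u v, t_p 1 u v) ∈ E` and
  `(|t_p 1 u v| - 1)₀ = m`. -/
  extend : ∀ m : ℕ, ∀ x ∈ E, ∀ u : List Bool, ∃ v : List Bool,
    (x.1 ++ false :: (u ++ v), x.2 ++ true :: (u ++ v)) ∈ E ∧
      firstCoord ((x.2 ++ true :: (u ++ v)).length - 1) = m
  /-- For `n > 0`, `(s_n, t_n) = (s_q 0 w, t_q 1 w)` for some `q < n` and some `w`. -/
  restrict : ∀ x ∈ E, 0 < x.1.length → ∃ y ∈ E, y.1.length < x.1.length ∧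
    ∃ w : List Bool, x.1 = y.1 ++ false :: w ∧ x.2 = y.2 ++ true :: w

/-- The tree generated by `E`. -/
def generatedTree (E : Set (List Bool × List Bool)) : Set (List Bool × List Bool) :=
  {x | (x.1 = [] ∧ x.2 = []) ∨
    ∃ y ∈ E, ∃ w : List Bool, x.1 = y.1 ++ false :: w ∧ x.2 = y.2 ++ true :: w}

/-! ### The maps `ρ₀^ξ` and the sets `H_{1+ξ}`, `S_{1+ξ}` -/

open Classical in
/-- `ρ₀(ε)(i) = 1` if `ε(⟨i, j⟩) = 0` for each `j`, and `ρ₀(ε)(i) = 0` otherwise. -/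
def rhoZero (ε : Cantor) : Cantor :=
  fun i => decide (∀ j : ℕ, ε (pairing i j) = false)

/-- A choice, for each countable limit ordinal `l`, of a sequence `(c l k)_k` of nonzero ordinals
below `l` whose infinite ordinal sum `∑_k c l k` (the supremum of the finite partial sums) is `l`. -/
def IsLimitDecomposition (c : Ordinal.{0} → ℕ → Ordinal.{0}) : Prop :=
  ∀ l : Ordinal.{0}, IsSuccLimit l → l < Ordinal.omega 1 →
    (∀ k, 0 < c l k ∧ c l k < l) ∧
      IsLUB (range fun n : ℕ => ((List.range n).map (c l)).sum) l

/-- Given a map `r` (which is `ρ₀^{ξ_k}` below), the map `ρ₀^{(k,k+1)}` that keeps the first `k`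
coordinates of `ε` and applies `r` to the rest. -/
def applyFrom (r : Cantor → Cantor) (k : ℕ) (ε : Cantor) : Cantor :=
  fun i => if i < k then ε i else r (fun j => ε (j + k)) (i - k)

/-- `ρ₀^{(0,k)} = ρ₀^{(k-1,k)} ∘ ⋯ ∘ ρ₀^{(0,1)}`, where `r k` is `ρ₀^{ξ_k}`. -/
def iterateFrom (r : ℕ → Cantor → Cantor) : ℕ → Cantor → Cantor
  | 0 => id
  | k + 1 => applyFrom (r k) k ∘ iterateFrom r k

/-- The map `ρ₀^ξ`, with respect to the choice `c` of sequences at limit ordinals. The value `id` in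
the limit case is never used when `c` is a limit decomposition and `ξ` is countable. -/
def rho (c : Ordinal.{0} → ℕ → Ordinal.{0}) (ξ : Ordinal.{0}) : Cantor → Cantor :=
  Ordinal.limitRecOn (motive := fun _ => Cantor → Cantor) ξ
    id
    (fun _ f => rhoZero ∘ f)
    (fun l _ ih => fun ε k =>
      iterateFrom (fun j => if h : c l j < l then ih (c l j) h else id) (k + 1) ε k)

/-- `H_{1+ξ}`, the inverse image of `{0^∞}` by `ρ₀^ξ`. -/
def setH (c : Ordinal.{0} → ℕ → Ordinal.{0}) (ξ : Ordinal.{0}) : Set Cantor :=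
  rho c ξ ⁻¹' {fun _ => false}

/-- The symmetric difference `α Δ β`. -/
def symmDiffSeq (α β : Cantor) : Cantor :=
  fun m => xor (α m) (β m)

/-- The shift map. -/
def shiftSeq (α : Cantor) : Cantor :=
  fun m => α (m + 1)

/-- `S_{1+ξ}`, the set of the branches `(α, β)` of `T` with `shift (α Δ β) ∉ H_{1+ξ}`. -/
def setS (c : Ordinal.{0} → ℕ → Ordinal.{0}) (T : Set (List Bool × List Bool))
    (ξ : Ordinal.{0}) : Set (Cantor × Cantor) :=
  {x | x ∈ branches T ∧ shiftSeq (symmDiffSeq x.1 x.2) ∉ setH c ξ}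

end

/-!
Say that a map `Φ` of `2^ω` splits coordinates if the coordinates of `Φ ε` depend on pairwise
disjoint sets of coordinates of `ε`. Each `ρ₀^ξ` does, so continuous reductions to its single
coordinates can be glued. By induction on `ξ`, this gives, for every `Σ⁰_{1+ξ}` set `A`, a
continuous `g` with `x ∈ A ↔ g x ∉ H_{1+ξ}`.

Membership in `H_{1+ξ}` depends only on `ρ₀ ε`, and every continuous `g` agrees up to `ρ₀` with some
`f` such that `f x m` depends only on `x|m`. Such an `f` has a fixed point. If `H_{1+ξ}` were
`Σ⁰_{1+ξ}`, the fixed point coming from `A = H_{1+ξ}` would be both inside and outside `H_{1+ξ}`.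

A finer Polish topology induces the original one on a comeagre set `G`. Condition (b) of a test
gives a continuous map `ε ↦ (f ε, g ε)` into `[T] ∩ (G × G)` with
`ρ₀(S(f ε Δ g ε)) = ρ₀(ε)`, so a potentially `Σ⁰_{1+ξ}` set whose trace on `[T]` is
`{(α, β) | S(α Δ β) ∈ H_{1+ξ}}` would make `H_{1+ξ}` itself `Σ⁰_{1+ξ}`.

The levels of `T` are acyclic because every edge is a bridge: level `p + 1` consists of two copies
of level `p` joined by the single edge `(s_p 0, t_p 1)`.
-/

/-! ### The Borel hierarchy -/

section Hierarchy

variable {X Y : Type*} [TopologicalSpace X] [TopologicalSpace Y] {ξ ζ : Ordinal.{0}} {A B : Set X}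

theorem IsSigma0.one_le (h : IsSigma0 ξ A) : 1 ≤ ξ := by
  cases h with
  | of_isOpen _ => exact le_rfl
  | iUnion hξ _ _ _ _ => exact hξ.le

theorem isSigma0_one_iff : IsSigma0 1 A ↔ IsOpen A := by
  refine ⟨fun h => ?_, IsSigma0.of_isOpen⟩
  generalize hξ : (1 : Ordinal.{0}) = ξ at h
  cases h with
  | of_isOpen h => exact h
  | iUnion h _ _ _ _ => exact absurd hξ h.ne

theorem IsSigma0.exists_iUnion (h : IsSigma0 ξ A) (hξ : 1 < ξ) :
    ∃ (B : ℕ → Set X) (η : ℕ → Ordinal.{0}),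
      (∀ n, 1 ≤ η n ∧ η n < ξ) ∧ (∀ n, IsSigma0 (η n) (B n)ᶜ) ∧ A = ⋃ n, B n := by
  cases h with
  | of_isOpen _ => exact absurd hξ (lt_irrefl _)
  | iUnion _ B η hη hB => exact ⟨B, η, hη, hB, rfl⟩

theorem IsSigma0.preimage {A : Set Y} (h : IsSigma0 ξ A) {f : X → Y} (hf : Continuous f) :
    IsSigma0 ξ (f ⁻¹' A) := by
  induction h with
  | of_isOpen hA => exact .of_isOpen (hA.preimage hf)
  | iUnion hξ A η hη _ ih =>
    rw [preimage_iUnion]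
    exact .iUnion hξ _ η hη ih

theorem IsSigma0.of_isClosed (hξ : 1 < ξ) (hA : IsClosed A) : IsSigma0 ξ A := by
  rw [← iUnion_const (ι := ℕ) A]
  exact .iUnion hξ _ (fun _ => 1) (fun _ => ⟨le_rfl, hξ⟩) fun _ => .of_isOpen hA.isOpen_compl

theorem IsSigma0.of_isClopen (hξ : 1 ≤ ξ) (hA : IsClopen A) : IsSigma0 ξ A := by
  rcases hξ.eq_or_lt with rfl | hξ
  · exact .of_isOpen hA.isOpen
  · exact .of_isClosed hξ hA.isClosed

theorem IsSigma0.iUnion_nat {A : ℕ → Set X} (h : ∀ n, IsSigma0 ξ (A n)) :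
    IsSigma0 ξ (⋃ n, A n) := by
  rcases (h 0).one_le.eq_or_lt with rfl | hξ
  · exact .of_isOpen (isOpen_iUnion fun n => isSigma0_one_iff.1 (h n))
  · choose B η hη hB hAB using fun n => (h n).exists_iUnion hξ
    rw [iUnion_congr hAB, ← Set.iUnion_unpair fun i j => B i j]
    exact .iUnion hξ _ (fun k => η k.unpair.1 k.unpair.2) (fun _ => hη _ _) (fun _ => hB _ _)

theorem IsSigma0.iUnion_countable {ι : Type*} [Countable ι] (hξ : 1 ≤ ξ) {A : ι → Set X}
    (h : ∀ i, IsSigma0 ξ (A i)) : IsSigma0 ξ (⋃ i, A i) := by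
  cases isEmpty_or_nonempty ι
  · rw [iUnion_of_empty]
    exact .of_isClopen hξ isClopen_empty
  · obtain ⟨e, he⟩ := exists_surjective_nat ι
    rw [← he.iUnion_comp]
    exact .iUnion_nat fun n => h _

theorem IsSigma0.union (hA : IsSigma0 ξ A) (hB : IsSigma0 ξ B) : IsSigma0 ξ (A ∪ B) := by
  rw [union_eq_iUnion]
  exact .iUnion_countable hA.one_le fun b => by cases b <;> assumption

variable [TopologicalSpace.PseudoMetrizableSpace X]

theorem IsSigma0.mono (h : IsSigma0 ξ A) (hξζ : ξ ≤ ζ) : IsSigma0 ζ A := by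
  rcases hξζ.eq_or_lt with rfl | hlt
  · exact h
  rcases h.one_le.eq_or_lt with rfl | hξ
  · let := TopologicalSpace.pseudoMetrizableSpacePseudoMetric X
    obtain ⟨F, hF, -, rfl, -⟩ := (isSigma0_one_iff.1 h).exists_iUnion_isClosed
    exact .iUnion_nat fun n => .of_isClosed hlt (hF n)
  · obtain ⟨B, η, hη, hB, rfl⟩ := h.exists_iUnion hξ
    exact .iUnion (hξ.trans hlt) B η (fun n => ⟨(hη n).1, (hη n).2.trans hlt⟩) hB

theorem IsSigma0.inter (hA : IsSigma0 ξ A) (hB : IsSigma0 ξ B) : IsSigma0 ξ (A ∩ B) := by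
  rcases hA.one_le.eq_or_lt with rfl | hξ
  · exact .of_isOpen ((isSigma0_one_iff.1 hA).inter (isSigma0_one_iff.1 hB))
  · obtain ⟨C, η, hη, hC, rfl⟩ := hA.exists_iUnion hξ
    obtain ⟨D, θ, hθ, hD, rfl⟩ := hB.exists_iUnion hξ
    rw [iUnion_inter]
    refine .iUnion_nat fun m => ?_
    rw [inter_iUnion]
    refine .iUnion hξ _ (fun n => max (η m) (θ n))
      (fun n => ⟨(hη m).1.trans (le_max_left _ _), max_lt (hη m).2 (hθ n).2⟩) fun n => ?_
    rw [compl_inter]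
    exact ((hC m).mono (le_max_left _ _)).union ((hD n).mono (le_max_right _ _))

theorem IsSigma0.biInter_finset {ι : Type*} (hξ : 1 ≤ ξ) {A : ι → Set X} (s : Finset ι)
    (h : ∀ i ∈ s, IsSigma0 ξ (A i)) : IsSigma0 ξ (⋂ i ∈ s, A i) := by
  classical
  induction s using Finset.induction_on with
  | empty => simpa using IsSigma0.of_isClopen (X := X) hξ isClopen_univ
  | insert a s _ ih =>
    rw [Finset.set_biInter_insert]
    exact (h a (s.mem_insert_self a)).inter (ih fun i hi => h i (Finset.mem_insert_of_mem hi))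

end Hierarchy

/-- `f` is of Baire class `η`: the preimages of open sets are in `Σ⁰_{1+η}`. With this indexing,
Baire classes add up under composition, also at infinite `η`. -/
def IsBaireClass {X Y : Type*} [TopologicalSpace X] [TopologicalSpace Y] (η : Ordinal.{0})
    (f : X → Y) : Prop :=
  ∀ U : Set Y, IsOpen U → IsSigma0 (1 + η) (f ⁻¹' U)

section BaireClass

variable {X Y Z : Type*} [TopologicalSpace X] [TopologicalSpace Y] [TopologicalSpace Z]
  {η ζ : Ordinal.{0}}

theorem isBaireClass_zero_of_continuous {f : X → Y} (hf : Continuous f) : IsBaireClass 0 f :=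
  fun U hU => by
    rw [add_zero]
    exact .of_isOpen (hU.preimage hf)

theorem IsBaireClass.isSigma0_preimage {f : X → Y} (hf : IsBaireClass η f) {A : Set Y}
    (hA : IsSigma0 (1 + ζ) A) : IsSigma0 (1 + (η + ζ)) (f ⁻¹' A) := by
  generalize hν : 1 + ζ = ν at hA
  induction hA generalizing ζ with
  | of_isOpen hA =>
    obtain rfl : ζ = 0 := add_left_cancel (hν.trans (add_zero 1).symm)
    rw [add_zero]
    exact hf _ hA
  | iUnion hξ A θ hθ _ ih =>
    subst hν
    have hsub : ∀ n, 1 + (θ n - 1) = θ n := fun n => Ordinal.add_sub_cancel_of_le (hθ n).1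
    have hlt : ∀ n, 1 + (η + (θ n - 1)) < 1 + (η + ζ) := fun n => by
      gcongr
      exact lt_of_add_lt_add_left ((hsub n).trans_lt (hθ n).2)
    rw [preimage_iUnion]
    exact .iUnion (le_self_add.trans_lt (hlt 0)) _ _ (fun n => ⟨le_self_add, hlt n⟩)
      fun n => ih n (hsub n)

theorem IsBaireClass.comp {g : Y → Z} {f : X → Y} (hg : IsBaireClass ζ g)
    (hf : IsBaireClass η f) : IsBaireClass (η + ζ) (g ∘ f) :=
  fun U hU => hf.isSigma0_preimage (hg U hU)

theorem isBaireClass_of_fiber [Countable Y] {f : X → Y}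
    (h : ∀ y, IsSigma0 (1 + η) (f ⁻¹' {y})) : IsBaireClass η f := fun U _ => by
  rw [← biUnion_preimage_singleton, biUnion_eq_iUnion]
  exact .iUnion_countable le_self_add fun y => h y

theorem IsBaireClass.mono [TopologicalSpace.PseudoMetrizableSpace X] {f : X → Y}
    (hf : IsBaireClass η f) (h : η ≤ ζ) : IsBaireClass ζ f :=
  fun U hU => (hf U hU).mono (by gcongr)

theorem isBaireClass_pi [TopologicalSpace.PseudoMetrizableSpace X] {ι : Type*} [Countable ι]
    {Y : ι → Type*} [∀ i, TopologicalSpace (Y i)] [∀ i, SecondCountableTopology (Y i)]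
    {f : X → ∀ i, Y i} (h : ∀ i, IsBaireClass η fun x => f x i) : IsBaireClass η f := by
  intro U hU
  have hbasis := isTopologicalBasis_pi fun i => TopologicalSpace.isBasis_countableBasis (Y i)
  rw [hbasis.open_eq_sUnion' hU]
  obtain ⟨T, hT, hTS, hTU⟩ := TopologicalSpace.isOpen_sUnion_countable _
    fun s (hs : s ∈ {s ∈ _ | s ⊆ U}) => hbasis.isOpen hs.1
  rw [← hTU, preimage_sUnion, biUnion_eq_iUnion]
  have := hT.to_subtype
  refine .iUnion_countable le_self_add fun ⟨s, hs⟩ => ?_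
  obtain ⟨V, F, hV, rfl⟩ := (hTS hs).1
  have : f ⁻¹' (F : Set ι).pi V = ⋂ i ∈ F, (fun x => f x i) ⁻¹' V i := by
    ext x
    simp only [mem_preimage, mem_pi, Finset.mem_coe, mem_iInter]
  rw [this]
  exact .biInter_finset le_self_add F fun i hi =>
    h i _ (TopologicalSpace.isOpen_of_mem_countableBasis (hV i hi))

end BaireClass

/-! ### The pairing function -/

theorem diagonalIndex_pairing (n p : ℕ) : diagonalIndex (pairing n p) = n + p := by
  have hmono : Monotone fun m => ∑ k ∈ Finset.range m, k := fun a b hab =>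
    Finset.sum_le_sum_of_subset (Finset.range_mono hab)
  have hle : ∀ m, m ≤ ∑ k ∈ Finset.range (m + 1), k := fun m => by
    rw [Finset.sum_range_succ]
    exact Nat.le_add_left _ _
  rw [diagonalIndex, Nat.findGreatest_eq_iff]
  refine ⟨(hle _).trans (Nat.le_add_right _ _), fun _ => Nat.le_add_right _ _, fun m hm _ h => ?_⟩
  have hnext : ∑ k ∈ Finset.range (n + p + 2), k ≤ ∑ k ∈ Finset.range (m + 1), k :=
    hmono (by omega)
  rw [Finset.sum_range_succ _ (n + p + 1)] at hnext
  rw [pairing] at h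
  omega

@[simp]
theorem firstCoord_pairing (n p : ℕ) : firstCoord (pairing n p) = n := by
  rw [firstCoord, diagonalIndex_pairing, pairing]
  omega

theorem pairing_right_injective (n : ℕ) : Function.Injective (pairing n) := fun p p' h => by
  have := congrArg diagonalIndex h
  rw [diagonalIndex_pairing, diagonalIndex_pairing] at this
  omega

theorem le_pairing_right (n p : ℕ) : p ≤ pairing n p := Nat.le_add_left _ _

theorem pairing_add_one_zero (p : ℕ) : pairing (p + 1) 0 = pairing 0 p + 1 := by
  simp only [pairing, add_zero, zero_add, Finset.sum_range_succ _ (p + 1)]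
  omega

theorem pairing_add_one_right (n p : ℕ) : pairing n (p + 1) = pairing (n + 1) p + 1 := by
  simp only [pairing, Nat.add_right_comm n 1 p, ← add_assoc]

theorem exists_pairing_eq (q : ℕ) : ∃ p, pairing (firstCoord q) p = q := by
  suffices h : ∃ n p, pairing n p = q by
    obtain ⟨n, p, rfl⟩ := h
    exact ⟨p, by rw [firstCoord_pairing]⟩
  induction q with
  | zero => exact ⟨0, 0, rfl⟩
  | succ q ih =>
    obtain ⟨_ | n, p, rfl⟩ := ih
    · exact ⟨p + 1, 0, pairing_add_one_zero p⟩
    · exact ⟨n, p + 1, pairing_add_one_right n p⟩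

theorem rhoZero_apply_eq_false_iff {y : Cantor} {i : ℕ} :
    rhoZero y i = false ↔ ∃ j, y (pairing i j) = true := by
  simp only [rhoZero, decide_eq_false_iff_not, not_forall, Bool.not_eq_false]

theorem rhoZero_eq_iff {y z : Cantor} :
    rhoZero y = rhoZero z ↔
      ∀ i, (∃ j, y (pairing i j) = true) ↔ ∃ j, z (pairing i j) = true := by
  simp only [funext_iff, ← rhoZero_apply_eq_false_iff]
  exact forall_congr' fun i => by cases rhoZero y i <;> cases rhoZero z i <;> decide

/-! ### Existence of tests -/

/-- The index `q` and the word `w` with `(s_{n+1}, t_{n+1}) = (s_q 0 w, t_q 1 w)` in the test built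
from `d`: they are the two components of `d n`, the first one capped at `n`, and the second one cut
or padded with `0`s to the only possible length `n - q`. -/
def testStep (d : ℕ → ℕ × List Bool) (n : ℕ) : ℕ × List Bool :=
  (min (d n).1 n, ((d n).2 ++ List.replicate n false).take (n - min (d n).1 n))

theorem testStep_fst_lt (d : ℕ → ℕ × List Bool) (n : ℕ) : (testStep d n).1 < n + 1 :=
  Nat.lt_succ_of_le (min_le_right _ _)

theorem testStep_length (d : ℕ → ℕ × List Bool) (n : ℕ) :
    (testStep d n).1 + (testStep d n).2.length = n := by
  simp only [testStep, List.length_take, List.length_append, List.length_replicate]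
  omega

theorem testStep_eq_append {d : ℕ → ℕ × List Bool} {n p : ℕ} {u : List Bool} (h : d n = (p, u))
    (hn : p + u.length ≤ n) : ∃ v, testStep d n = (p, u ++ v) := by
  have hp : min p n = p := by omega
  have hu : u.take (n - p) = u := List.take_of_length_le (by omega)
  exact ⟨_, by rw [testStep, h, hp, List.take_append, hu]⟩

/-- The sequence `(s_n, t_n)` of the test built from `d`. -/
def testSeq (d : ℕ → ℕ × List Bool) : ℕ → List Bool × List Bool
  | 0 => ([], [])
  | n + 1 =>
    have := testStep_fst_lt d n
    ((testSeq d (testStep d n).1).1 ++ false :: (testStep d n).2,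
      (testSeq d (testStep d n).1).2 ++ true :: (testStep d n).2)

theorem testSeq_add_one (d : ℕ → ℕ × List Bool) (n : ℕ) :
    testSeq d (n + 1) = ((testSeq d (testStep d n).1).1 ++ false :: (testStep d n).2,
      (testSeq d (testStep d n).1).2 ++ true :: (testStep d n).2) := by
  rw [testSeq]

theorem testSeq_length (d : ℕ → ℕ × List Bool) (n : ℕ) :
    (testSeq d n).1.length = n ∧ (testSeq d n).2.length = n := by
  induction n using Nat.strong_induction_on with
  | _ n ih =>
    cases n with
    | zero => simp [testSeq]
    | succ n =>
      have hstep := ih _ (testStep_fst_lt d n)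
      have hlength := testStep_length d n
      simp only [testSeq_add_one, List.length_append, List.length_cons]
      omega

theorem isTest_range_testSeq {d : ℕ → ℕ × List Bool}
    (hd : ∀ m p u, ∃ n, firstCoord n = m ∧ d n = (p, u) ∧ p + u.length ≤ n) :
    IsTest (range (testSeq d)) where
  length_eq := by
    rintro _ ⟨n, rfl⟩
    rw [(testSeq_length d n).1, (testSeq_length d n).2]
  existsUnique q := by
    refine ⟨testSeq d q, ⟨⟨q, rfl⟩, testSeq_length d q⟩, ?_⟩
    rintro _ ⟨⟨n, rfl⟩, h, -⟩
    rw [← h, (testSeq_length d n).1]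
  extend := by
    rintro m _ ⟨p, rfl⟩ u
    obtain ⟨n, rfl, hdn, hn⟩ := hd m p u
    obtain ⟨v, hv⟩ := testStep_eq_append hdn hn
    have hseq := testSeq_add_one d n
    rw [hv] at hseq
    refine ⟨v, ⟨n + 1, hseq⟩, ?_⟩
    have hlength := (testSeq_length d (n + 1)).2
    rw [hseq] at hlength
    rw [hlength, Nat.add_sub_cancel]
  restrict := by
    rintro _ ⟨_ | n, rfl⟩ hn
    · exact absurd hn (by simp [testSeq])
    · refine ⟨_, ⟨(testStep d n).1, rfl⟩, ?_, (testStep d n).2, ?_⟩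
      · rw [(testSeq_length d _).1, (testSeq_length d _).1]
        exact testStep_fst_lt d n
      · rw [testSeq_add_one]
        exact ⟨rfl, rfl⟩

theorem exists_isTest : ∃ E : Set (List Bool × List Bool), IsTest E := by
  choose snd hsnd using exists_pairing_eq
  have hsnd' : ∀ m j, snd (pairing m j) = j := fun m j =>
    pairing_right_injective m (by simpa using hsnd (pairing m j))
  refine ⟨_, isTest_range_testSeq (d := fun n =>
    (Encodable.decode (α := ℕ × List Bool) (snd n).unpair.1).getD (0, [])) fun m p u =>
    ⟨pairing m (Nat.pair (Encodable.encode (p, u)) (p + u.length)), firstCoord_pairing _ _, ?_,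
      (Nat.right_le_pair _ _).trans (le_pairing_right _ _)⟩⟩
  simp only [hsnd', Nat.unpair_pair, Encodable.encodek, Option.getD_some]

/-! ### Existence of limit decompositions -/

theorem countable_Iio_of_lt_omega_one {l : Ordinal.{0}} (hl : l < Ordinal.omega 1) :
    (Iio l).Countable := by
  have hcard : l.card < Cardinal.aleph 1 := by rwa [← Cardinal.lt_ord, Cardinal.ord_aleph]
  rw [← Cardinal.le_aleph0_iff_set_countable, Cardinal.mk_Iio_ordinal, ← Order.lt_succ_iff,
    Cardinal.succ_aleph0]
  simpa using Cardinal.lift_lt.2 hcard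

theorem exists_strictMono_isLUB {α : Type*} [LinearOrder α] [OrderBot α] [SuccOrder α] {l : α}
    (hl : IsSuccLimit l) (hcount : (Iio l).Countable) :
    ∃ a : ℕ → α, a 0 = ⊥ ∧ StrictMono a ∧ (∀ n, a n < l) ∧ IsLUB (range a) l := by
  obtain ⟨e, he⟩ := hcount.exists_eq_range ⟨⊥, hl.bot_lt⟩
  have hel : ∀ n, e n < l := fun n => he.ge (mem_range_self n)
  let a : ℕ → α := fun n => Nat.rec ⊥ (fun n x => Order.succ (max x (e n))) n
  have hal : ∀ n, a n < l := fun n => by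
    induction n with
    | zero => exact hl.bot_lt
    | succ n ih => exact hl.succ_lt (max_lt ih (hel n))
  have hlt : ∀ n, max (a n) (e n) < a (n + 1) := fun n =>
    Order.lt_succ_of_not_isMax ((max_lt (hal n) (hel n)).not_isMax)
  refine ⟨a, rfl, strictMono_nat_of_lt_succ fun n => (le_max_left _ _).trans_lt (hlt n), hal,
    forall_mem_range.2 fun n => (hal n).le, fun b hb => le_of_forall_lt fun x hx => ?_⟩
  obtain ⟨n, rfl⟩ := he.le hx
  exact ((le_max_right _ _).trans_lt (hlt n)).trans_le (hb ⟨n + 1, rfl⟩)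

theorem sum_range_map_sub_of_monotone {a : ℕ → Ordinal.{0}} (ha : Monotone a) (h0 : a 0 = 0)
    (n : ℕ) : ((List.range n).map fun k => a (k + 1) - a k).sum = a n := by
  induction n with
  | zero => exact h0.symm
  | succ n ih =>
    rw [List.sum_range_succ, ih]
    exact Ordinal.add_sub_cancel_of_le (ha n.le_succ)

theorem exists_isLimitDecomposition :
    ∃ c : Ordinal.{0} → ℕ → Ordinal.{0}, IsLimitDecomposition c := by
  have hex : ∀ l : Ordinal.{0}, ∃ f : ℕ → Ordinal.{0}, IsSuccLimit l → l < Ordinal.omega 1 →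
      (∀ k, 0 < f k ∧ f k < l) ∧
        IsLUB (range fun n : ℕ => ((List.range n).map f).sum) l := by
    intro l
    by_cases hl : IsSuccLimit l ∧ l < Ordinal.omega 1
    · obtain ⟨a, h0, ha, hal, hlub⟩ :=
        exists_strictMono_isLUB hl.1 (countable_Iio_of_lt_omega_one hl.2)
      refine ⟨fun k => a (k + 1) - a k, fun _ _ => ⟨fun k => ⟨?_, ?_⟩, ?_⟩⟩
      · rw [pos_iff_ne_zero, ne_eq, Ordinal.sub_eq_zero_iff_le, not_le]
        exact ha k.lt_succ_self
      · exact (Ordinal.sub_le_self _ _).trans_lt (hal (k + 1))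
      · simpa only [sum_range_map_sub_of_monotone ha.monotone h0] using hlub
    · exact ⟨fun _ => 0, fun hlim hlt => absurd ⟨hlim, hlt⟩ hl⟩
  choose c hc using hex
  exact ⟨c, hc⟩

/-! ### Acyclicity of the levels -/

section GeneratedTree

variable {E T : Set (List Bool × List Bool)}

theorem nil_mem_generatedTree (E : Set (List Bool × List Bool)) : ([], []) ∈ generatedTree E :=
  Or.inl ⟨rfl, rfl⟩

theorem append_mem_generatedTree {y : List Bool × List Bool} (hy : y ∈ E) (w : List Bool) :
    (y.1 ++ false :: w, y.2 ++ true :: w) ∈ generatedTree E :=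
  Or.inr ⟨y, hy, w, rfl, rfl⟩

theorem eq_nil_or_concat_of_mem_generatedTree {x : List Bool × List Bool}
    (hx : x ∈ generatedTree E) :
    x = ([], []) ∨ (∃ z ∈ generatedTree E, ∃ b, x = (z.1 ++ [b], z.2 ++ [b])) ∨
      ∃ y ∈ E, x = (y.1 ++ [false], y.2 ++ [true]) := by
  rcases hx with ⟨h1, h2⟩ | ⟨y, hy, w, h1, h2⟩
  · exact Or.inl (Prod.ext h1 h2)
  · rcases List.eq_nil_or_concat w with rfl | ⟨w, b, rfl⟩
    · exact Or.inr (Or.inr ⟨y, hy, Prod.ext h1 h2⟩)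
    · exact Or.inr (Or.inl ⟨_, append_mem_generatedTree hy w, b,
        Prod.ext (by simp [h1]) (by simp [h2])⟩)

theorem IsTest.subset_generatedTree (hE : IsTest E) : E ⊆ generatedTree E := by
  intro x hx
  rcases Nat.eq_zero_or_pos x.1.length with h0 | hpos
  · exact Or.inl ⟨List.length_eq_zero_iff.1 h0, List.length_eq_zero_iff.1 (hE.length_eq x hx ▸ h0)⟩
  · obtain ⟨y, hy, -, hw⟩ := hE.restrict x hx hpos
    exact Or.inr ⟨y, hy, hw⟩

theorem IsTest.generatedTree_induction (hE : IsTest E)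
    {P : ∀ x : List Bool × List Bool, x ∈ generatedTree E → Prop}
    (nil : P ([], []) (nil_mem_generatedTree E))
    (concat : ∀ z hz b hzb, P z hz → P (z.1 ++ [b], z.2 ++ [b]) hzb)
    (edge : ∀ y (hy : y ∈ E), P y (hE.subset_generatedTree hy) →
      P (y.1 ++ [false], y.2 ++ [true]) (append_mem_generatedTree hy []))
    {x : List Bool × List Bool} (hx : x ∈ generatedTree E) : P x hx := by
  induction hk : x.1.length generalizing x with
  | zero =>
    rcases eq_nil_or_concat_of_mem_generatedTree hx with rfl | ⟨z, -, b, rfl⟩ | ⟨y, -, rfl⟩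
    · exact nil
    · simp at hk
    · simp at hk
  | succ k ih =>
    rcases eq_nil_or_concat_of_mem_generatedTree hx with rfl | ⟨z, hz, b, rfl⟩ | ⟨y, hy, rfl⟩
    · exact nil
    · exact concat z hz b hx (ih hz (by simpa using hk))
    · exact edge y hy (ih (hE.subset_generatedTree hy) (by simpa using hk))

theorem IsTest.length_eq_of_mem_generatedTree (hE : IsTest E) {x : List Bool × List Bool}
    (hx : x ∈ generatedTree E) : x.1.length = x.2.length := by
  rcases hx with ⟨h1, h2⟩ | ⟨y, hy, w, h1, h2⟩
  · rw [h1, h2]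
  · rw [h1, h2, List.length_append, List.length_append, hE.length_eq y hy]
    rfl

theorem take_concat_pair_mem {z : List Bool × List Bool} {a b : Bool}
    (hlength : z.1.length = z.2.length) (hmem : (z.1 ++ [a], z.2 ++ [b]) ∈ T) {n : ℕ}
    (htake : (z.1.take n, z.2.take n) ∈ T) :
    ((z.1 ++ [a]).take n, (z.2 ++ [b]).take n) ∈ T := by
  rcases le_or_gt n z.1.length with hn | hn
  · rwa [List.take_append_of_le_length hn, List.take_append_of_le_length (hlength ▸ hn)]
  · rwa [List.take_of_length_le (by simpa using hn),
      List.take_of_length_le (by simpa [← hlength] using hn)]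

theorem IsTest.isBinaryPairTree (hE : IsTest E) : IsBinaryPairTree (generatedTree E) := by
  refine ⟨fun x => hE.length_eq_of_mem_generatedTree, fun x hx n => ?_⟩
  induction hx using hE.generatedTree_induction with
  | nil => simpa using nil_mem_generatedTree E
  | concat z hz b hzb ih =>
    exact take_concat_pair_mem (hE.length_eq_of_mem_generatedTree hz) hzb ih
  | edge y hy ih =>
    exact take_concat_pair_mem (hE.length_eq y hy) (append_mem_generatedTree hy []) ih

theorem IsTest.eq_of_length (hE : IsTest E) {x y : List Bool × List Bool} (hx : x ∈ E) (hy : y ∈ E)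
    (h : x.1.length = y.1.length) : x = y :=
  (hE.existsUnique y.1.length).unique ⟨hx, h, hE.length_eq x hx ▸ h⟩
    ⟨hy, rfl, (hE.length_eq y hy).symm⟩

/-- `(χ₀, χ₁)` is one side of a cut of the level of `e`, seen as a bipartite graph, and `e` is the
only edge of that level across the cut. -/
def IsCut (T : Set (List Bool × List Bool)) (e : List Bool × List Bool)
    (χ₀ χ₁ : Set (List Bool)) : Prop :=
  e.1 ∈ χ₀ ∧ e.2 ∉ χ₁ ∧ ∀ x ∈ T, x.1.length = e.1.length → x ≠ e → (x.1 ∈ χ₀ ↔ x.2 ∈ χ₁)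

/-- The set of words `Lb` with `L ∈ χ` if `b = a`, and with the constant truth value `K`
if `b ≠ a`. -/
def liftAlong (a : Bool) (χ : Set (List Bool)) (K : Prop) : Set (List Bool) :=
  {L | if L.getLast? = some a then L.dropLast ∈ χ else K}

theorem concat_mem_liftAlong {a b : Bool} {χ : Set (List Bool)} {K : Prop} {L : List Bool} :
    L ++ [b] ∈ liftAlong a χ K ↔ if b = a then L ∈ χ else K := by
  simp [liftAlong]

theorem IsTest.isCut_nil (hE : IsTest E) : IsCut (generatedTree E) ([], []) univ ∅ := by
  refine ⟨mem_univ _, notMem_empty _, fun x hx hlength hne => absurd ?_ hne⟩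
  have hlength' := hE.length_eq_of_mem_generatedTree hx
  exact Prod.ext (List.length_eq_zero_iff.1 hlength)
    (List.length_eq_zero_iff.1 (hlength' ▸ hlength))

/-- Level `p + 1` consists of two copies of level `p`, joined by the edge `(s_p 0, t_p 1)`. In the
other copy, the cut is put entirely on the side of the endpoint of that edge lying in this copy. -/
theorem IsTest.exists_isCut_concat (hE : IsTest E) {z : List Bool × List Bool}
    {χ₀ χ₁ : Set (List Bool)} (h : IsCut (generatedTree E) z χ₀ χ₁) (a : Bool) :
    ∃ χ₀' χ₁', IsCut (generatedTree E) (z.1 ++ [a], z.2 ++ [a]) χ₀' χ₁' := by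
  obtain ⟨q, ⟨hq, hlq, -⟩, -⟩ := hE.existsUnique z.1.length
  let K : Prop := if a = true then q.2 ∈ χ₁ else q.1 ∈ χ₀
  refine ⟨liftAlong a χ₀ K, liftAlong a χ₁ K, by simpa [concat_mem_liftAlong] using h.1,
    by simpa [concat_mem_liftAlong] using h.2.1, fun x hx hlx hne => ?_⟩
  rcases eq_nil_or_concat_of_mem_generatedTree hx with rfl | ⟨u, hu, b, rfl⟩ | ⟨y, hy, rfl⟩
  · simp at hlx
  · simp only [concat_mem_liftAlong]
    split_ifs with hba
    · subst hba
      exact h.2.2 u hu (by simpa using hlx) fun huz => hne (huz ▸ rfl)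
    · rfl
  · obtain rfl := hE.eq_of_length hy hq ((by simpa using hlx : y.1.length = _).trans hlq.symm)
    cases a <;> simp [concat_mem_liftAlong, K]

theorem IsTest.isCut_edge (hE : IsTest E) {y : List Bool × List Bool} (hy : y ∈ E) :
    IsCut (generatedTree E) (y.1 ++ [false], y.2 ++ [true])
      {L | L.getLast? = some false} {L | L.getLast? = some false} := by
  refine ⟨by simp, by simp, fun x hx hlength hne => ?_⟩
  rcases eq_nil_or_concat_of_mem_generatedTree hx with rfl | ⟨u, -, b, rfl⟩ | ⟨q, hq, rfl⟩
  · simp at hlength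
  · simp
  · obtain rfl := hE.eq_of_length hq hy (by simpa using hlength)
    exact absurd rfl hne

theorem IsTest.exists_isCut (hE : IsTest E) {e : List Bool × List Bool}
    (he : e ∈ generatedTree E) : ∃ χ₀ χ₁, IsCut (generatedTree E) e χ₀ χ₁ := by
  induction he using hE.generatedTree_induction with
  | nil => exact ⟨_, _, hE.isCut_nil⟩
  | concat z _ b _ ih =>
    obtain ⟨χ₀, χ₁, h⟩ := ih
    exact hE.exists_isCut_concat h b
  | edge y hy _ => exact ⟨_, _, hE.isCut_edge hy⟩

theorem iff_of_reachable {V : Type*} {G : SimpleGraph V} {χ : V → Prop}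
    (h : ∀ u v, G.Adj u v → (χ u ↔ χ v)) {u v : V} (huv : G.Reachable u v) : χ u ↔ χ v := by
  obtain ⟨p⟩ := huv
  induction p with
  | nil => exact Iff.rfl
  | cons hadj _ ih => exact (h _ _ hadj).trans ih

theorem forall_bipartiteGraphOf_adj {F₀ F₁ : Type*} {R : Set (F₀ × F₁)}
    {P : F₀ ⊕ F₁ → F₀ ⊕ F₁ → Prop} (symm : ∀ u v, P u v → P v u)
    (edge : ∀ f₀ f₁, (f₀, f₁) ∈ R → P (Sum.inl f₀) (Sum.inr f₁)) {u v : F₀ ⊕ F₁}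
    (h : (bipartiteGraphOf R).Adj u v) : P u v := by
  rw [bipartiteGraphOf, SimpleGraph.fromRel_adj] at h
  obtain ⟨-, ⟨f₀, f₁, hf, rfl, rfl⟩ | ⟨f₀, f₁, hf, rfl, rfl⟩⟩ := h
  · exact edge f₀ f₁ hf
  · exact symm _ _ (edge f₀ f₁ hf)

theorem isAcyclic_bipartiteGraphOf {F₀ F₁ : Type*} {R : Set (F₀ × F₁)}
    (hcut : ∀ e ∈ R, ∃ (χ₀ : Set F₀) (χ₁ : Set F₁), e.1 ∈ χ₀ ∧ e.2 ∉ χ₁ ∧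
      ∀ x ∈ R, x ≠ e → (x.1 ∈ χ₀ ↔ x.2 ∈ χ₁)) : (bipartiteGraphOf R).IsAcyclic := by
  rw [SimpleGraph.isAcyclic_iff_forall_adj_isBridge]
  refine fun v w => forall_bipartiteGraphOf_adj
    (P := fun v w => (bipartiteGraphOf R).IsBridge s(v, w))
    (fun u v h => Sym2.eq_swap (a := u) ▸ h) fun f₀ f₁ hf => ?_
  obtain ⟨χ₀, χ₁, h₀, h₁, hχ⟩ := hcut _ hf
  rw [SimpleGraph.isBridge_iff]
  intro hreach
  let χ : F₀ ⊕ F₁ → Prop := Sum.elim (· ∈ χ₀) (· ∈ χ₁)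
  refine h₁ ((iff_of_reachable (χ := χ) (fun u v huv => ?_) hreach).1 h₀)
  rw [SimpleGraph.deleteEdges_adj] at huv
  refine forall_bipartiteGraphOf_adj
    (P := fun u v => s(u, v) ∉ {s(Sum.inl f₀, Sum.inr f₁)} → (χ u ↔ χ v))
    (fun u v h hne => (h (Sym2.eq_swap (a := u) ▸ hne)).symm) (fun g₀ g₁ hg hne => ?_)
    huv.1 huv.2
  refine hχ (g₀, g₁) hg fun heq => hne ?_
  obtain ⟨rfl, rfl⟩ := Prod.mk.inj heq
  exact mem_singleton _

theorem IsTest.isTreeWithAcyclicLevels (hE : IsTest E) :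
    IsTreeWithAcyclicLevels (generatedTree E) := by
  refine ⟨hE.isBinaryPairTree, fun p => isAcyclic_bipartiteGraphOf fun e he => ?_⟩
  obtain ⟨χ₀, χ₁, h₀, h₁, h⟩ := hE.exists_isCut he
  refine ⟨{f | f.toList ∈ χ₀}, {f | f.toList ∈ χ₁}, h₀, h₁, fun x hx hne => ?_⟩
  refine h _ hx (by simp) fun heq => hne ?_
  obtain ⟨heq₀, heq₁⟩ := Prod.mk.inj heq
  exact Prod.ext (List.Vector.toList_injective heq₀) (List.Vector.toList_injective heq₁)

end GeneratedTree

/-! ### The maps `ρ₀^ξ` -/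

/-- The maps `G_0 = id` and `G_{k+1} = shift ∘ r k ∘ G_k`: the coordinates of `iterateFrom r k ε`
from the `k`-th one on. -/
def tailIter (r : ℕ → Cantor → Cantor) : ℕ → Cantor → Cantor
  | 0 => id
  | k + 1 => shiftSeq ∘ r k ∘ tailIter r k

/-- The limit `⋯ ∘ ρ₀^{(1,2)} ∘ ρ₀^{(0,1)}` that defines `ρ₀^ξ` at limit ordinals, where `r k` is
`ρ₀^{ξ_k}`. -/
def limitMap (r : ℕ → Cantor → Cantor) (ε : Cantor) : Cantor :=
  fun k => iterateFrom r (k + 1) ε k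

theorem iterateFrom_apply_add (r : ℕ → Cantor → Cantor) (k : ℕ) (ε : Cantor) (j : ℕ) :
    iterateFrom r k ε (j + k) = tailIter r k ε j := by
  induction k generalizing j with
  | zero => rfl
  | succ k ih =>
    simp only [iterateFrom, Function.comp_apply, applyFrom, ih, tailIter, shiftSeq]
    rw [if_neg (by omega), show j + (k + 1) - k = j + 1 by omega]

theorem limitMap_apply (r : ℕ → Cantor → Cantor) (ε : Cantor) (k : ℕ) :
    limitMap r ε k = (r k ∘ tailIter r k) ε 0 := by
  have htail : (fun j => iterateFrom r k ε (j + k)) = tailIter r k ε :=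
    funext (iterateFrom_apply_add r k ε)
  simp only [limitMap, iterateFrom, Function.comp_apply, applyFrom, htail, lt_irrefl, if_false,
    Nat.sub_self]

section Rho

variable {c : Ordinal.{0} → ℕ → Ordinal.{0}} {ξ : Ordinal.{0}}

theorem rho_zero : rho c 0 = id := by rw [rho, Ordinal.limitRecOn_zero]

theorem rho_add_one (ξ : Ordinal.{0}) : rho c (ξ + 1) = rhoZero ∘ rho c ξ := by
  rw [rho, Ordinal.limitRecOn_add_one]
  rfl

theorem IsLimitDecomposition.rho_limit (hc : IsLimitDecomposition c) {l : Ordinal.{0}}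
    (hl : IsSuccLimit l) (hω : l < Ordinal.omega 1) :
    rho c l = limitMap fun k => rho c (c l k) := by
  rw [rho, Ordinal.limitRecOn_limit _ _ _ _ hl]
  simp only [((hc l hl hω).1 _).2, dif_pos]
  rfl

theorem IsLimitDecomposition.rho_induction (hc : IsLimitDecomposition c)
    {P : Ordinal.{0} → (Cantor → Cantor) → Prop} (zero : P 0 id)
    (add_one : ∀ ξ r, P ξ r → P (ξ + 1) (rhoZero ∘ r))
    (limit : ∀ l (ξ : ℕ → Ordinal.{0}) r, IsSuccLimit l → (∀ k, 0 < ξ k) →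
      IsLUB (range fun n => ((List.range n).map ξ).sum) l → (∀ k, P (ξ k) (r k)) →
      P l (limitMap r))
    (hξ : ξ < Ordinal.omega 1) : P ξ (rho c ξ) := by
  induction ξ using Ordinal.limitRecOn with
  | zero => exact rho_zero (c := c) ▸ zero
  | add_one ξ ih => exact rho_add_one (c := c) ξ ▸ add_one ξ _ (ih ((lt_add_one ξ).trans hξ))
  | limit l hl ih =>
    obtain ⟨hcl, hsum⟩ := hc l hl hξ
    rw [hc.rho_limit hl hξ]
    exact limit l (c l) _ hl (fun k => (hcl k).1) hsum
      fun k => ih _ (hcl k).2 ((hcl k).2.trans hξ)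

theorem continuous_shiftSeq : Continuous shiftSeq :=
  continuous_pi fun i => continuous_apply (i + 1)

theorem isClosed_setOf_rhoZero_apply_eq_true (i : ℕ) :
    IsClosed {ε : Cantor | rhoZero ε i = true} := by
  simp only [rhoZero, decide_eq_true_eq, Set.ofPred_forall]
  exact isClosed_iInter fun j => isClosed_eq (continuous_apply _) continuous_const

theorem isBaireClass_rhoZero : IsBaireClass 1 rhoZero := by
  have hone : (1 : Ordinal.{0}) < 1 + 1 := lt_add_one 1
  refine isBaireClass_pi fun i => isBaireClass_of_fiber fun b => ?_
  have hclosed := isClosed_setOf_rhoZero_apply_eq_true i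
  cases b with
  | true => exact .of_isClosed hone hclosed
  | false =>
    refine IsSigma0.mono (.of_isOpen ?_) hone.le
    convert hclosed.isOpen_compl using 1
    ext ε
    simp

theorem IsBaireClass.tailIter {r : ℕ → Cantor → Cantor} {ξ : ℕ → Ordinal.{0}}
    (h : ∀ k, IsBaireClass (ξ k) (r k)) (k : ℕ) :
    IsBaireClass ((List.range k).map ξ).sum (tailIter r k) := by
  induction k with
  | zero => exact isBaireClass_zero_of_continuous continuous_id
  | succ k ih =>
    have := (isBaireClass_zero_of_continuous continuous_shiftSeq).comp ((h k).comp ih)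
    rwa [add_zero, ← List.sum_range_succ] at this

theorem IsBaireClass.limitMap {r : ℕ → Cantor → Cantor} {ξ : ℕ → Ordinal.{0}} {l : Ordinal.{0}}
    (h : ∀ k, IsBaireClass (ξ k) (r k))
    (hl : l ∈ upperBounds (range fun n => ((List.range n).map ξ).sum)) :
    IsBaireClass l (limitMap r) := by
  refine isBaireClass_pi fun k => ?_
  simp only [limitMap_apply]
  have := (isBaireClass_zero_of_continuous (continuous_apply (A := fun _ : ℕ => Bool) 0)).comp
    ((h k).comp (IsBaireClass.tailIter h k))
  rw [add_zero, ← List.sum_range_succ] at this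
  exact this.mono (hl ⟨k + 1, rfl⟩)

theorem IsLimitDecomposition.isBaireClass_rho (hc : IsLimitDecomposition c)
    (hξ : ξ < Ordinal.omega 1) : IsBaireClass ξ (rho c ξ) :=
  hc.rho_induction (isBaireClass_zero_of_continuous continuous_id)
    (fun _ _ h => isBaireClass_rhoZero.comp h) (fun _ _ _ _ _ hl h => .limitMap h hl.1) hξ

theorem IsLimitDecomposition.isSigma0_compl_setH (hc : IsLimitDecomposition c)
    (hξ : ξ < Ordinal.omega 1) : IsSigma0 (1 + ξ) (setH c ξ)ᶜ :=
  hc.isBaireClass_rho hξ _ isClosed_singleton.isOpen_compl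

theorem factorsThrough_rhoZero_limitMap {r : ℕ → Cantor → Cantor}
    (h : ∀ k, (r k).FactorsThrough rhoZero) : (limitMap r).FactorsThrough rhoZero := by
  have htail : ∀ k, (r k ∘ tailIter r k).FactorsThrough rhoZero := fun k => by
    induction k with
    | zero => exact h 0
    | succ k ih => exact fun y z hyz => congrArg (r (k + 1) ∘ shiftSeq) (ih hyz)
  intro y z hyz
  ext1 k
  rw [limitMap_apply, limitMap_apply, htail k hyz]

theorem IsLimitDecomposition.factorsThrough_rhoZero_rho (hc : IsLimitDecomposition c)
    (hξ : ξ < Ordinal.omega 1) (h0 : ξ ≠ 0) : (rho c ξ).FactorsThrough rhoZero := by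
  refine (hc.rho_induction (P := fun ξ r => (ξ = 0 → r = id) ∧ (ξ ≠ 0 → r.FactorsThrough rhoZero))
    ⟨fun _ => rfl, fun h => absurd rfl h⟩ (fun ξ r h => ⟨fun h0 => ?_, fun _ => ?_⟩)
    (fun l ξ r hl hpos _ h => ⟨fun h0 => ?_, fun _ => ?_⟩) hξ).2 h0
  · exact absurd h0 (by simp)
  · by_cases hξ0 : ξ = 0
    · rw [h.1 hξ0]
      exact fun _ _ => id
    · exact fun y z hyz => congrArg rhoZero (h.2 hξ0 hyz)
  · exact absurd h0 hl.bot_lt.ne'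
  · exact factorsThrough_rhoZero_limitMap fun k => (h k).2 (hpos k).ne'

theorem eq_zeroSeq_iff_rhoZero {y : Cantor} :
    y = (fun _ => false) ↔ rhoZero y = fun _ => true := by
  simp only [funext_iff, rhoZero, decide_eq_true_eq]
  refine ⟨fun h i j => h _, fun h q => ?_⟩
  obtain ⟨p, hp⟩ := exists_pairing_eq q
  rw [← hp]
  exact h _ _

theorem IsLimitDecomposition.mem_setH_congr (hc : IsLimitDecomposition c)
    (hξ : ξ < Ordinal.omega 1) {y z : Cantor} (h : rhoZero y = rhoZero z) :
    y ∈ setH c ξ ↔ z ∈ setH c ξ := by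
  simp only [setH, mem_preimage, mem_singleton_iff]
  rcases eq_or_ne ξ 0 with rfl | h0
  · rw [rho_zero, id, id, eq_zeroSeq_iff_rhoZero, eq_zeroSeq_iff_rhoZero, h]
  · rw [hc.factorsThrough_rhoZero_rho hξ h0 h]

end Rho

/-! ### Splitting of the coordinates -/

/-- `o m` is the only coordinate of `Φ ε` that may depend on `ε m`. -/
def IsCoordOwner (o : ℕ → ℕ) (Φ : Cantor → Cantor) : Prop :=
  ∀ i, DependsOn (fun ε => Φ ε i) (o ⁻¹' {i})

/-- The coordinates of `Φ ε` depend on pairwise disjoint sets of coordinates of `ε`. -/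
def SplitsCoords (Φ : Cantor → Cantor) : Prop :=
  ∃ o, IsCoordOwner o Φ

section SplitsCoords

variable {Φ Ψ : Cantor → Cantor} {r : ℕ → Cantor → Cantor}

theorem isCoordOwner_id : IsCoordOwner id id := fun i _ _ h => h i rfl

theorem IsCoordOwner.comp {o o' : ℕ → ℕ} (h' : IsCoordOwner o' Ψ) (h : IsCoordOwner o Φ) :
    IsCoordOwner (o' ∘ o) (Ψ ∘ Φ) := fun i _ _ hεδ =>
  h' i fun j hj => h j fun m hm => hεδ m (hm ▸ hj : o' (o m) = i)

theorem isCoordOwner_shiftSeq : IsCoordOwner Nat.pred shiftSeq := fun i _ _ h =>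
  h (i + 1) (Nat.pred_succ i)

theorem isCoordOwner_rhoZero : IsCoordOwner firstCoord rhoZero := fun i ε δ h => by
  simp only [rhoZero, decide_eq_decide]
  exact forall_congr' fun j => by rw [h _ (firstCoord_pairing i j)]

/-- The owners of the coordinates for `applyFrom r k`, given those for `r`. -/
def applyFromOwner (o : ℕ → ℕ) (k m : ℕ) : ℕ :=
  if m < k then m else o (m - k) + k

theorem IsCoordOwner.applyFrom {r : Cantor → Cantor} {o : ℕ → ℕ} (h : IsCoordOwner o r) (k : ℕ) :
    IsCoordOwner (applyFromOwner o k) (applyFrom r k) := by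
  intro i ε δ hεδ
  by_cases hi : i < k
  · simpa only [_root_.applyFrom, if_pos hi] using hεδ i (if_pos hi)
  · simp only [_root_.applyFrom, if_neg hi]
    refine h (i - k) fun m (hm : o m = i - k) => hεδ (m + k) ?_
    simp only [applyFromOwner, mem_preimage, mem_singleton_iff, Nat.add_sub_cancel, hm]
    rw [if_neg (by omega)]
    omega

/-- The owners of the coordinates for `iterateFrom r`, given those for each `r k`. -/
def iterateFromOwner (o : ℕ → ℕ → ℕ) : ℕ → ℕ → ℕ
  | 0 => id
  | k + 1 => applyFromOwner (o k) k ∘ iterateFromOwner o k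

theorem IsCoordOwner.iterateFrom {o : ℕ → ℕ → ℕ} (h : ∀ k, IsCoordOwner (o k) (r k)) (k : ℕ) :
    IsCoordOwner (iterateFromOwner o k) (iterateFrom r k) := by
  induction k with
  | zero => exact isCoordOwner_id
  | succ k ih => exact ((h k).applyFrom k).comp ih

theorem iterateFromOwner_eq_of_lt {o : ℕ → ℕ → ℕ} {m k n : ℕ} (h : iterateFromOwner o k m < k)
    (hkn : k ≤ n) : iterateFromOwner o n m = iterateFromOwner o k m := by
  induction n, hkn using Nat.le_induction with
  | base => rfl
  | succ n hkn ih =>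
    rw [← ih, iterateFromOwner, Function.comp_apply, applyFromOwner, if_pos (by omega)]

theorem splitsCoords_id : SplitsCoords id := ⟨_, isCoordOwner_id⟩

theorem splitsCoords_shiftSeq : SplitsCoords shiftSeq := ⟨_, isCoordOwner_shiftSeq⟩

theorem splitsCoords_rhoZero : SplitsCoords rhoZero := ⟨_, isCoordOwner_rhoZero⟩

theorem SplitsCoords.comp (hΨ : SplitsCoords Ψ) (hΦ : SplitsCoords Φ) : SplitsCoords (Ψ ∘ Φ) :=
  ⟨_, hΨ.choose_spec.comp hΦ.choose_spec⟩

theorem SplitsCoords.tailIter (hr : ∀ k, SplitsCoords (r k)) (k : ℕ) :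
    SplitsCoords (tailIter r k) := by
  induction k with
  | zero => exact splitsCoords_id
  | succ k ih => exact splitsCoords_shiftSeq.comp ((hr k).comp ih)

theorem SplitsCoords.limitMap (hr : ∀ k, SplitsCoords (r k)) : SplitsCoords (limitMap r) := by
  classical
  choose o ho using hr
  -- Once the owner of `m` is some `k < n`, the later maps `ρ₀^{(n,n+1)}` keep the coordinate `k`.
  have hunique : ∀ m k n, iterateFromOwner o (k + 1) m = k → iterateFromOwner o (n + 1) m = n →
      k ≤ n := fun m k n hk hn => by
    by_contra! hlt
    have := iterateFromOwner_eq_of_lt (hn.trans_lt (lt_add_one n)) (by omega : n + 1 ≤ k + 1)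
    omega
  refine ⟨fun m => if h : ∃ k, iterateFromOwner o (k + 1) m = k then h.choose else 0,
    fun k => (IsCoordOwner.iterateFrom ho (k + 1) k).mono fun m (hm : _ = k) => ?_⟩
  have h : ∃ k, iterateFromOwner o (k + 1) m = k := ⟨k, hm⟩
  simp only [mem_preimage, mem_singleton_iff, dif_pos h]
  exact (hunique m _ _ h.choose_spec hm).antisymm (hunique m _ _ hm h.choose_spec)

theorem SplitsCoords.exists_glue (hΦ : SplitsCoords Φ) {X : Type*} [TopologicalSpace X]
    {g : ℕ → X → Cantor} (hg : ∀ i, Continuous (g i)) :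
    ∃ f : X → Cantor, Continuous f ∧ ∀ x i, Φ (f x) i = Φ (g i x) i := by
  obtain ⟨o, ho⟩ := hΦ
  refine ⟨fun x m => g (o m) x m, continuous_pi fun m => (continuous_apply m).comp (hg (o m)),
    fun x i => ho i fun m hm => ?_⟩
  exact congrArg (fun j => g j x m) hm

end SplitsCoords

/-! ### Wadge hardness of the maps `ρ₀^ξ` -/

/-- `A` is Wadge reducible to `B`: it is the inverse image of `B` by a continuous map. -/
def IsWadgeReducible {X Y : Type*} [TopologicalSpace X] [TopologicalSpace Y] (A : Set X)
    (B : Set Y) : Prop :=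
  ∃ g : X → Y, Continuous g ∧ ∀ x, x ∈ A ↔ g x ∈ B

/-- The set `{ε | Φ ε i = 1}` is `Π⁰_ν`-hard. -/
def PiHardAt (ν : Ordinal.{0}) (Φ : Cantor → Cantor) (i : ℕ) : Prop :=
  ∀ A : Set Cantor, IsPi0 ν A → IsWadgeReducible A {ε | Φ ε i = true}

/-- For every infinite set `{ι n | n}` of coordinates, `{ε | ∃ n, Φ ε (ι n) = 1}` is
`Σ⁰_ν`-hard. -/
def SigmaHard (ν : Ordinal.{0}) (Φ : Cantor → Cantor) : Prop :=
  ∀ ι : ℕ → ℕ, Function.Injective ι → ∀ A : Set Cantor, IsSigma0 ν A →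
    IsWadgeReducible A {ε | ∃ n, Φ ε (ι n) = true}

/-- Composing with `r` raises hardness by `ξ`, as composing with `ρ₀^ξ` does. -/
def RaisesHardness (ξ : Ordinal.{0}) (r : Cantor → Cantor) : Prop :=
  ∀ ⦃ν : Ordinal.{0}⦄ ⦃Φ : Cantor → Cantor⦄, 1 ≤ ν → SplitsCoords Φ → SigmaHard ν Φ →
    SigmaHard (ν + ξ) (r ∘ Φ) ∧ (ξ ≠ 0 → ∀ i, PiHardAt ν (r ∘ Φ) i)

theorem exists_cylinder_subset {U : Set Cantor} (hU : IsOpen U) {x : Cantor} (hx : x ∈ U) :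
    ∃ n, PiNat.cylinder x n ⊆ U := by
  obtain ⟨_, ⟨y, n, rfl⟩, hxy, hyU⟩ :=
    (PiNat.isTopologicalBasis_cylinders fun _ : ℕ => Bool).exists_subset_of_mem_open hx hU
  exact ⟨n, PiNat.mem_cylinder_iff_eq.1 hxy ▸ hyU⟩

theorem isClopen_setOf_cylinder_subset (U : Set Cantor) (n : ℕ) :
    IsClopen {x | PiNat.cylinder x n ⊆ U} := by
  have hconst : IsLocallyConstant fun x => PiNat.cylinder x n ⊆ U :=
    (IsLocallyConstant.iff_exists_open _).2 fun x =>
      ⟨_, PiNat.isOpen_cylinder _ x n, PiNat.self_mem_cylinder x n, fun y hy => by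
        rw [PiNat.mem_cylinder_iff_eq.1 hy]⟩
  simpa only [eq_iff_iff, iff_true] using hconst.isClopen_fiber True

section Hardness

variable {ν : Ordinal.{0}} {Φ : Cantor → Cantor}

theorem PiHardAt.mono {η : Ordinal.{0}} {i : ℕ} (h : PiHardAt ν Φ i) (hη : η ≤ ν) :
    PiHardAt η Φ i := fun A hA => h A (IsSigma0.mono hA hη)

theorem SplitsCoords.isWadgeReducible_iUnion (hΦ : SplitsCoords Φ) {X : Type*}
    [TopologicalSpace X] {ι : ℕ → ℕ} (hι : Function.Injective ι) {A : ℕ → Set X}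
    (hA : ∀ n, IsWadgeReducible (A n) {ε | Φ ε (ι n) = true}) :
    IsWadgeReducible (⋃ n, A n) {ε | ∃ n, Φ ε (ι n) = true} := by
  choose g hg hgA using hA
  obtain ⟨f, hf, hfg⟩ := hΦ.exists_glue (g := fun i => g (Function.invFun ι i)) fun i => hg _
  refine ⟨f, hf, fun x => ?_⟩
  simp only [mem_iUnion, hgA, mem_ofPred_eq, hfg, Function.leftInverse_invFun hι _]

theorem isWadgeReducible_setOf_apply_eq_true {A : Set Cantor} (hA : IsClopen A) (i : ℕ) :
    IsWadgeReducible A {ε : Cantor | ε i = true} :=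
  ⟨fun x _ => A.boolIndicator x,
    continuous_pi fun _ => (continuous_boolIndicator_iff_isClopen A).2 hA, A.mem_iff_boolIndicator⟩

theorem sigmaHard_id : SigmaHard 1 id := by
  intro ι hι A hA
  have hAU : A = ⋃ n, {x | PiNat.cylinder x n ⊆ A} := by
    ext x
    rw [mem_iUnion]
    exact ⟨exists_cylinder_subset (isSigma0_one_iff.1 hA),
      fun ⟨n, hn⟩ => hn (PiNat.self_mem_cylinder x n)⟩
  rw [hAU]
  exact splitsCoords_id.isWadgeReducible_iUnion hι fun n =>
    isWadgeReducible_setOf_apply_eq_true (isClopen_setOf_cylinder_subset A n) _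

theorem SigmaHard.shiftSeq (h : SigmaHard ν Φ) : SigmaHard ν (shiftSeq ∘ Φ) :=
  fun _ hι => h _ ((add_left_injective 1).comp hι)

theorem SigmaHard.piHardAt_rhoZero (h : SigmaHard ν Φ) (i : ℕ) : PiHardAt ν (rhoZero ∘ Φ) i := by
  intro A hA
  obtain ⟨g, hg, hgA⟩ := h (pairing i) (pairing_right_injective i) _ hA
  refine ⟨g, hg, fun x => ?_⟩
  have hfalse : x ∉ A ↔ rhoZero (Φ (g x)) i = false :=
    (hgA x).trans rhoZero_apply_eq_false_iff.symm
  rw [← not_iff_not, hfalse, mem_ofPred_eq, Function.comp_apply, Bool.not_eq_true]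

/-- A `Σ⁰_ν` set is a union of sets `B n` of lower multiplicative classes; each `B n` is placed on
infinitely many coordinates, so that it occurs on one where `Φ` is hard enough for it. -/
theorem sigmaHard_of_eventually_piHardAt (hΦ : SplitsCoords Φ) (hν : 1 < ν)
    (hone : ∀ i, PiHardAt 1 Φ i) (hlt : ∀ η < ν, ∀ᶠ i in Filter.atTop, PiHardAt η Φ i) :
    SigmaHard ν Φ := by
  classical
  intro ι hι A hA
  obtain ⟨B, η, hη, hB, rfl⟩ := hA.exists_iUnion hν
  let C : ℕ → Set Cantor := fun m =>
    if PiHardAt (η m.unpair.1) Φ (ι m) then B m.unpair.1 else ∅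
  have hBC : ⋃ n, B n = ⋃ m, C m := by
    refine Subset.antisymm (iUnion_subset fun n => ?_) (iUnion_subset fun m => ?_)
    · have hinj : Function.Injective fun t => ι (Nat.pair n t) := fun a b hab =>
        (Nat.pair_eq_pair.1 (hι hab)).2
      obtain ⟨t, ht⟩ := (hinj.nat_tendsto_atTop.eventually (hlt _ (hη n).2)).exists
      refine Subset.trans ?_ (subset_iUnion C (Nat.pair n t))
      simp only [C, Nat.unpair_pair, if_pos ht, Subset.rfl]
    · simp only [C]
      split_ifs
      exacts [subset_iUnion B _, empty_subset _]
  rw [hBC]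
  refine hΦ.isWadgeReducible_iUnion hι fun m => ?_
  simp only [C]
  split_ifs with h
  · exact h _ (hB _)
  · exact hone _ _ (.of_isClopen le_rfl isClopen_empty.compl)

theorem raisesHardness_id : RaisesHardness 0 id := fun ν _ _ _ h =>
  ⟨(add_zero ν).symm ▸ h, fun h0 => absurd rfl h0⟩

theorem RaisesHardness.rhoZero_comp {ξ : Ordinal.{0}} {r : Cantor → Cantor}
    (h : RaisesHardness ξ r) (hr : SplitsCoords r) : RaisesHardness (ξ + 1) (rhoZero ∘ r) := by
  intro ν Φ hν hΦ hhard
  have hpi : ∀ i, PiHardAt (ν + ξ) (rhoZero ∘ r ∘ Φ) i := (h hν hΦ hhard).1.piHardAt_rhoZero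
  refine ⟨sigmaHard_of_eventually_piHardAt ((splitsCoords_rhoZero.comp hr).comp hΦ) ?_
    (fun i => (hpi i).mono (hν.trans le_self_add)) fun η hη => .of_forall fun i => ?_,
    fun _ i => (hpi i).mono le_self_add⟩
  · rw [← add_assoc, lt_add_one_iff]
    exact hν.trans le_self_add
  · rw [← add_assoc, lt_add_one_iff] at hη
    exact (hpi i).mono hη

theorem SigmaHard.tailIter {ξ : ℕ → Ordinal.{0}} {r : ℕ → Cantor → Cantor}
    (h : ∀ k, RaisesHardness (ξ k) (r k)) (hr : ∀ k, SplitsCoords (r k)) (hν : 1 ≤ ν)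
    (hΦ : SplitsCoords Φ) (hhard : SigmaHard ν Φ) (k : ℕ) :
    SigmaHard (ν + ((List.range k).map ξ).sum) (tailIter r k ∘ Φ) := by
  induction k with
  | zero => rwa [List.range_zero, List.map_nil, List.sum_nil, add_zero]
  | succ k ih =>
    rw [List.sum_range_succ, ← add_assoc]
    exact (h k (hν.trans le_self_add) ((SplitsCoords.tailIter hr k).comp hΦ) ih).1.shiftSeq

theorem RaisesHardness.limitMap {l : Ordinal.{0}} (hl : IsSuccLimit l) {ξ : ℕ → Ordinal.{0}}
    {r : ℕ → Cantor → Cantor} (hpos : ∀ k, 0 < ξ k)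
    (hlub : IsLUB (range fun n => ((List.range n).map ξ).sum) l)
    (h : ∀ k, RaisesHardness (ξ k) (r k)) (hr : ∀ k, SplitsCoords (r k)) :
    RaisesHardness l (limitMap r) := by
  intro ν Φ hν hΦ hhard
  have hpi : ∀ k, PiHardAt (ν + ((List.range k).map ξ).sum) (_root_.limitMap r ∘ Φ) k := by
    intro k
    have := (h k (hν.trans le_self_add) ((SplitsCoords.tailIter hr k).comp hΦ)
      (SigmaHard.tailIter h hr hν hΦ hhard k)).2 (hpos k).ne' 0
    simpa only [PiHardAt, Function.comp_apply, limitMap_apply] using this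
  refine ⟨sigmaHard_of_eventually_piHardAt ((SplitsCoords.limitMap hr).comp hΦ)
    (hν.trans_lt (lt_add_of_pos_right ν hl.bot_lt))
    (fun i => (hpi i).mono (hν.trans le_self_add)) fun η hη => ?_,
    fun _ i => (hpi i).mono le_self_add⟩
  obtain ⟨ζ, hζ, hηζ⟩ := (Ordinal.lt_add_iff_of_isSuccLimit hl).1 hη
  obtain ⟨_, ⟨K, rfl⟩, hK, -⟩ := hlub.exists_between hζ
  have hmono : Monotone fun n => ((List.range n).map ξ).sum := monotone_nat_of_le_succ fun n => by
    rw [List.sum_range_succ]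
    exact le_self_add
  filter_upwards [Filter.eventually_ge_atTop K] with i hi
  refine (hpi i).mono (hηζ.le.trans ?_)
  gcongr
  exact hK.le.trans (hmono hi)

theorem IsLimitDecomposition.raisesHardness_rho {c : Ordinal.{0} → ℕ → Ordinal.{0}}
    (hc : IsLimitDecomposition c) {ξ : Ordinal.{0}} (hξ : ξ < Ordinal.omega 1) :
    RaisesHardness ξ (rho c ξ) :=
  (hc.rho_induction (P := fun ξ r => SplitsCoords r ∧ RaisesHardness ξ r)
    ⟨splitsCoords_id, raisesHardness_id⟩
    (fun _ _ h => ⟨splitsCoords_rhoZero.comp h.1, h.2.rhoZero_comp h.1⟩)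
    (fun _ _ _ hl hpos hlub h => ⟨.limitMap fun k => (h k).1,
      .limitMap hl hpos hlub (fun k => (h k).2) fun k => (h k).1⟩) hξ).2

end Hardness

/-! ### The set `H_{1+ξ}` is not `Σ⁰_{1+ξ}` -/

/-- `f x` gets a `1` in row `i`, at the place `m = ⟨i, p⟩`, once `x|m` forces a `1` in row `i` of
`g x`. As `p` is arbitrarily large, waiting loses nothing for `ρ₀`. -/
theorem exists_dependsOn_Iio_rhoZero_eq {g : Cantor → Cantor} (hg : Continuous g) :
    ∃ f : Cantor → Cantor, (∀ m, DependsOn (fun x => f x m) (Iio m)) ∧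
      ∀ x, rhoZero (f x) = rhoZero (g x) := by
  classical
  refine ⟨fun x m => decide (∃ j ≤ m, ∀ y ∈ PiNat.cylinder x m,
    g y (pairing (firstCoord m) j) = true), fun m x y h => ?_, fun x => rhoZero_eq_iff.2 fun i =>
    ⟨fun ⟨p, hp⟩ => ?_, fun ⟨j, hj⟩ => ?_⟩⟩
  · simp only [PiNat.mem_cylinder_iff_eq.1 (PiNat.mem_cylinder_iff.2 h)]
  · obtain ⟨j, -, hj⟩ := of_decide_eq_true hp
    exact ⟨j, firstCoord_pairing i p ▸ hj x (PiNat.self_mem_cylinder x _)⟩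
  · have hopen : IsOpen {y | g y (pairing i j) = true} :=
      (isOpen_discrete {true}).preimage ((continuous_apply (pairing i j)).comp hg)
    obtain ⟨n, hn⟩ := exists_cylinder_subset hopen hj
    have hle := le_pairing_right i (max j n)
    refine ⟨max j n, decide_eq_true ⟨j, (le_max_left j n).trans hle, fun y hy => ?_⟩⟩
    rw [firstCoord_pairing]
    exact hn (PiNat.cylinder_anti x ((le_max_right j n).trans hle) hy)

theorem exists_eq_of_dependsOn_Iio {β : Type*} [Nonempty β] {f : (ℕ → β) → ℕ → β}
    (hf : ∀ m, DependsOn (fun x => f x m) (Iio m)) : ∃ x, f x = x := by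
  classical
  obtain ⟨b⟩ := ‹Nonempty β›
  let x : ℕ → β := fun m => Nat.strongRec (motive := fun _ => β)
    (fun m ih => f (fun k => if h : k < m then ih k h else b) m) m
  have hx : ∀ m, x m = f (fun k => if k < m then x k else b) m := fun m => by
    simp only [x]
    rw [Nat.strongRec]
    rfl
  refine ⟨x, funext fun m => ?_⟩
  rw [hx m]
  exact hf m fun k hk => (if_pos hk).symm

theorem IsLimitDecomposition.not_isSigma0_setH {c : Ordinal.{0} → ℕ → Ordinal.{0}}
    (hc : IsLimitDecomposition c) {ξ : Ordinal.{0}} (hξ : ξ < Ordinal.omega 1) :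
    ¬ IsSigma0 (1 + ξ) (setH c ξ) := by
  intro hH
  obtain ⟨g, hg, hgH⟩ :=
    (hc.raisesHardness_rho hξ le_rfl splitsCoords_id sigmaHard_id).1 id Function.injective_id _ hH
  obtain ⟨f, hf, hfg⟩ := exists_dependsOn_Iio_rhoZero_eq hg
  obtain ⟨x, hx⟩ := exists_eq_of_dependsOn_Iio hf
  have hmem : x ∈ setH c ξ ↔ g x ∈ setH c ξ := by
    rw [← hc.mem_setH_congr hξ (hfg x), hx]
  have hnot : g x ∉ setH c ξ ↔ ∃ n, rho c ξ (g x) n = true := by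
    simp only [setH, mem_preimage, mem_singleton_iff, funext_iff, not_forall, Bool.not_eq_false]
  exact iff_not_self ((hmem.symm.trans (hgH x)).trans hnot.symm)

/-! ### Finer Polish topologies -/

theorem exists_residual_continuousOn_of_measurable {X Y : Type*} [TopologicalSpace X]
    [MeasurableSpace X] [BorelSpace X] [TopologicalSpace Y] [SecondCountableTopology Y]
    [MeasurableSpace Y] [OpensMeasurableSpace Y] {f : X → Y} (hf : Measurable f) :
    ∃ G ∈ residual X, ContinuousOn f G := by
  have hbasis := TopologicalSpace.isBasis_countableBasis Y
  have hopen : ∀ b ∈ TopologicalSpace.countableBasis Y,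
      ∃ u : Set X, IsOpen u ∧ f ⁻¹' b =ᶠ[residual X] u := fun b hb =>
    (hf (hbasis.isOpen hb).measurableSet).residualEq_isOpen
  choose! u hu hbu using hopen
  refine ⟨{x | ∀ b ∈ TopologicalSpace.countableBasis Y, x ∈ f ⁻¹' b ↔ x ∈ u b}, ?_, ?_⟩
  · exact (eventually_countable_ball (TopologicalSpace.countable_countableBasis Y)).2
      fun b hb => Filter.eventuallyEq_set.1 (hbu b hb)
  · rw [continuousOn_iff_continuous_domRestrict, hbasis.continuous_iff]
    intro b hb
    convert (hu b hb).preimage continuous_subtype_val using 1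
    ext x
    exact x.2 b hb

theorem exists_residual_continuousOn_id {X : Type*} {σ t : TopologicalSpace X}
    (hσ : @PolishSpace X σ) (ht : @PolishSpace X t) (h : σ ≤ t) :
    ∃ G ∈ @residual X t, @ContinuousOn X X t σ id G := by
  let : MeasurableSpace X := @borel X t
  have hBorel : @BorelSpace X t _ := @BorelSpace.mk X t _ rfl
  have hBorelσ : @BorelSpace X σ _ :=
    @BorelSpace.mk X σ _ (MeasureTheory.borel_eq_borel_of_le hσ ht h).symm
  have hσ₂ : @SecondCountableTopology X σ := hσ.toSecondCountableTopology
  exact @exists_residual_continuousOn_of_measurable X X t _ hBorel σ hσ₂ _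
    (@BorelSpace.opensMeasurable X σ _ hBorelσ) id measurable_id

theorem IsPotSigma0.exists_residual {X Y : Type*} [tX : TopologicalSpace X]
    [tY : TopologicalSpace Y] [hX : PolishSpace X] [hY : PolishSpace Y] {ν : Ordinal.{0}}
    {A : Set (X × Y)} (hA : IsPotSigma0 ν A) :
    ∃ G ∈ residual X, ∃ H ∈ residual Y, IsSigma0 ν (Subtype.val ⁻¹' A : Set ↥(G ×ˢ H)) := by
  have hfst (G : Set X) (H : Set Y) : Continuous fun x : ↥(G ×ˢ H) => x.1.1 :=
    continuous_fst.comp continuous_subtype_val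
  have hsnd (G : Set X) (H : Set Y) : Continuous fun x : ↥(G ×ˢ H) => x.1.2 :=
    continuous_snd.comp continuous_subtype_val
  obtain ⟨σ, τ, hσ, hτ, hσP, hτP, hA⟩ := hA
  obtain ⟨G, hG, hGσ⟩ := exists_residual_continuousOn_id hσP hX hσ
  obtain ⟨H, hH, hHτ⟩ := exists_residual_continuousOn_id hτP hY hτ
  let tGH := @instTopologicalSpaceSubtype _ (· ∈ G ×ˢ H) (@instTopologicalSpaceProd X Y tX tY)
  have hfstσ : @Continuous _ X tGH σ fun x : ↥(G ×ˢ H) => x.1.1 :=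
    @ContinuousOn.comp_continuous _ _ _ tGH tX σ id _ _ hGσ (hfst G H) fun x => x.2.1
  have hsndτ : @Continuous _ Y tGH τ fun x : ↥(G ×ˢ H) => x.1.2 :=
    @ContinuousOn.comp_continuous _ _ _ tGH tY τ id _ _ hHτ (hsnd G H) fun x => x.2.2
  exact ⟨G, hG, H, hH, @IsSigma0.preimage _ _ tGH (@instTopologicalSpaceProd X Y σ τ) _ _ hA _
    (@Continuous.prodMk _ _ _ σ τ tGH _ _ hfstσ hsndτ)⟩

theorem exists_seq_isOpen_dense_iInter_subset {X : Type*} [TopologicalSpace X] [BaireSpace X]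
    {G : Set X} (hG : G ∈ residual X) :
    ∃ O : ℕ → Set X, (∀ n, IsOpen (O n)) ∧ (∀ n, Dense (O n)) ∧ ⋂ n, O n ⊆ G := by
  obtain ⟨t, htG, ht, htd⟩ := mem_residual.1 hG
  obtain ⟨O, hO, rfl⟩ := ht.eq_iInter_nat
  exact ⟨O, hO, fun n => htd.mono (iInter_subset O n), htG⟩

/-! ### Finite and infinite binary sequences -/

/-- The basic clopen set `N_L` of the infinite sequences with initial segment `L`. -/
def cylinderOf (L : List Bool) : Set Cantor :=
  {x | initSeg x L.length = L}

theorem mem_cylinderOf_iff {L : List Bool} {x : Cantor} :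
    x ∈ cylinderOf L ↔ ∀ k (hk : k < L.length), x k = L[k] := by
  rw [cylinderOf, mem_ofPred_eq, List.ext_getElem_iff]
  simp [initSeg]

theorem initSeg_eq_take {L : List Bool} {x : Cantor} (hx : x ∈ cylinderOf L) {n : ℕ}
    (hn : n ≤ L.length) : initSeg x n = L.take n := by
  rw [mem_cylinderOf_iff] at hx
  refine List.ext_getElem (by simpa [initSeg] using hn) fun k hk _ => ?_
  simp only [initSeg, List.length_ofFn] at hk
  simpa [initSeg] using hx k (hk.trans_le hn)

theorem cylinderOf_append_subset (L M : List Bool) : cylinderOf (L ++ M) ⊆ cylinderOf L :=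
  fun x hx => by
    rw [cylinderOf, mem_ofPred_eq, initSeg_eq_take hx (by simp), List.take_left]

theorem exists_cylinderOf_append_subset {O : Set Cantor} (ho : IsOpen O) (hd : Dense O)
    (L : List Bool) : ∃ M, cylinderOf (L ++ M) ⊆ O := by
  let y : Cantor := fun k => L.getD k false
  obtain ⟨x, hxy, hxO⟩ := hd.inter_open_nonempty _ (PiNat.isOpen_cylinder _ y L.length)
    ⟨y, PiNat.self_mem_cylinder y _⟩
  obtain ⟨n, hn⟩ := exists_cylinder_subset ho hxO
  refine ⟨List.ofFn fun i : Fin n => x (L.length + i), fun z hz => hn fun k hk => ?_⟩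
  rw [mem_cylinderOf_iff] at hz
  rw [hz k (by simp; omega), List.getElem_append]
  split_ifs with hkL
  · rw [hxy k hkL]
    exact (List.getD_eq_getElem _ _ hkL).symm
  · simp [Nat.add_sub_cancel' (not_lt.1 hkL)]

/-- The limit of an increasing sequence `L` of finite sequences with `n ≤ (L n).length`. -/
def listLimit (L : ℕ → List Bool) : Cantor :=
  fun k => (L (k + 1)).getD k false

theorem listLimit_mem_cylinderOf {L : ℕ → List Bool} (hL : ∀ n, L n <+: L (n + 1))
    (hlen : ∀ n, n ≤ (L n).length) (n : ℕ) : listLimit L ∈ cylinderOf (L n) := by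
  have hmono : ∀ ⦃m n⦄, m ≤ n → L m <+: L n := fun m n hmn => by
    induction n, hmn using Nat.le_induction with
    | base => exact List.prefix_rfl
    | succ n _ ih => exact ih.trans (hL n)
  refine mem_cylinderOf_iff.2 fun k hk => ?_
  rw [listLimit, List.getD_eq_getElem _ _ (hlen (k + 1))]
  rcases le_total n (k + 1) with h | h
  · exact ((hmono h).getElem hk).symm
  · exact (hmono h).getElem _

theorem continuous_listLimit {X : Type*} [TopologicalSpace X] {L : X → ℕ → List Bool}
    (hL : ∀ n, IsLocallyConstant fun x => L x n) : Continuous fun x => listLimit (L x) :=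
  continuous_pi fun k => ((hL (k + 1)).comp fun M => M.getD k false).continuous

theorem isClosed_branches (T : Set (List Bool × List Bool)) : IsClosed (branches T) := by
  have hcont : ∀ n, Continuous fun x : Cantor × Cantor =>
      ((fun i : Fin n => x.1 i, fun i : Fin n => x.2 i) : (Fin n → Bool) × (Fin n → Bool)) :=
    fun n => by fun_prop
  simp only [branches, Set.ofPred_forall]
  exact isClosed_iInter fun n =>
    (isClosed_discrete {x : (Fin n → Bool) × (Fin n → Bool) |
      (List.ofFn x.1, List.ofFn x.2) ∈ T}).preimage (hcont n)

/-! ### Continuous maps into the branches of the tree generated by a test -/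

section Branches

/-- `(s, t) ↦ (s0v, tbv)`. -/
def extendPair (b : Bool) (v : List Bool) (p : List Bool × List Bool) : List Bool × List Bool :=
  (p.1 ++ false :: v, p.2 ++ b :: v)

/-- The pairs `p_0 = (∅, ∅)` and `p_{n+1} = (s0v, tbv)`, where `p_n = (s, t)`, `b = δ(n)` and `v` is
given by a strategy depending on `n`, `b` and `p_n`. -/
def pairSeq (v : ℕ → Bool → List Bool × List Bool → List Bool) (δ : Cantor) :
    ℕ → List Bool × List Bool
  | 0 => ([], [])
  | n + 1 => extendPair (δ n) (v n (δ n) (pairSeq v δ n)) (pairSeq v δ n)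

variable (v : ℕ → Bool → List Bool × List Bool → List Bool) (δ : Cantor)

theorem length_pairSeq_snd (n : ℕ) :
    (pairSeq v δ n).2.length = (pairSeq v δ n).1.length := by
  induction n with
  | zero => rfl
  | succ n ih => simp [pairSeq, extendPair, ih]

theorem strictMono_length_pairSeq : StrictMono fun n => (pairSeq v δ n).1.length :=
  strictMono_nat_of_lt_succ fun n => by simp [pairSeq, extendPair]

theorem isLocallyConstant_pairSeq (n : ℕ) : IsLocallyConstant fun δ => pairSeq v δ n := by
  induction n with
  | zero => exact IsLocallyConstant.const _
  | succ n ih =>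
    exact ((IsLocallyConstant.iff_continuous _).2 (continuous_apply n)).comp₂ ih
      fun b p => extendPair b (v n b p) p

/-- The limits of the two components of `pairSeq v δ`. -/
def pairLimit : Cantor × Cantor :=
  (listLimit fun n => (pairSeq v δ n).1, listLimit fun n => (pairSeq v δ n).2)

theorem pairLimit_mem_cylinderOf (n : ℕ) :
    (pairLimit v δ).1 ∈ cylinderOf (pairSeq v δ n).1 ∧
      (pairLimit v δ).2 ∈ cylinderOf (pairSeq v δ n).2 := by
  have hle : ∀ n, n ≤ (pairSeq v δ n).1.length := fun _ =>
    (strictMono_length_pairSeq v δ).le_apply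
  exact ⟨listLimit_mem_cylinderOf (fun _ => List.prefix_append _ _) hle n,
    listLimit_mem_cylinderOf (fun _ => List.prefix_append _ _)
      (fun n => length_pairSeq_snd v δ n ▸ hle n) n⟩

theorem continuous_pairLimit : Continuous (pairLimit v) :=
  (continuous_listLimit fun n => (isLocallyConstant_pairSeq v n).comp Prod.fst).prodMk
    (continuous_listLimit fun n => (isLocallyConstant_pairSeq v n).comp Prod.snd)

theorem symmDiffSeq_of_mem_cylinderOf_extendPair {p : List Bool × List Bool} {b : Bool}
    {w : List Bool} {α β : Cantor} (hp : p.2.length = p.1.length)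
    (hα : α ∈ cylinderOf (extendPair b w p).1) (hβ : β ∈ cylinderOf (extendPair b w p).2) {k : ℕ}
    (hk : p.1.length ≤ k) (hk' : k < (extendPair b w p).1.length) :
    symmDiffSeq α β k = true ↔ b = true ∧ k = p.1.length := by
  rw [mem_cylinderOf_iff] at hα hβ
  have hk'' : k < (extendPair b w p).2.length := by simpa [extendPair, hp] using hk'
  rw [symmDiffSeq, hα k hk', hβ k hk'']
  obtain ⟨j, rfl⟩ := Nat.exists_eq_add_of_le hk
  cases j <;> simp [extendPair, hp]

theorem symmDiffSeq_pairLimit_eq_true_iff {k : ℕ} :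
    symmDiffSeq (pairLimit v δ).1 (pairLimit v δ).2 k = true ↔
      ∃ n, δ n = true ∧ k = (pairSeq v δ n).1.length := by
  have hmono := strictMono_length_pairSeq v δ
  have hstep : ∀ n, (pairSeq v δ n).1.length ≤ k → k < (pairSeq v δ (n + 1)).1.length →
      (symmDiffSeq (pairLimit v δ).1 (pairLimit v δ).2 k = true ↔
        δ n = true ∧ k = (pairSeq v δ n).1.length) := fun n =>
    symmDiffSeq_of_mem_cylinderOf_extendPair (length_pairSeq_snd v δ n)
      (pairLimit_mem_cylinderOf v δ (n + 1)).1 (pairLimit_mem_cylinderOf v δ (n + 1)).2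
  constructor
  · intro hk
    obtain ⟨n, hn, hn'⟩ := hmono.exists_between_of_tendsto_atTop hmono.tendsto_atTop k.succ_pos
    exact ⟨n, (hstep n (Nat.le_of_lt_succ hn) hn').1 hk⟩
  · rintro ⟨n, hδ, rfl⟩
    exact (hstep n le_rfl (hmono n.lt_succ_self)).2 ⟨hδ, rfl⟩

/-- The value `δ (n + 1)` is found again at the place `|p_{n+1}|` of the symmetric difference, and
`hrow` says that, after the shift, this place is in the same row as `n`. -/
theorem rhoZero_shiftSeq_symmDiffSeq_pairLimit
    (hrow : ∀ n, firstCoord ((pairSeq v δ (n + 1)).1.length - 1) = firstCoord n) :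
    rhoZero (shiftSeq (symmDiffSeq (pairLimit v δ).1 (pairLimit v δ).2)) =
      rhoZero (shiftSeq δ) := by
  simp only [rhoZero_eq_iff, shiftSeq, symmDiffSeq_pairLimit_eq_true_iff]
  refine fun i => ⟨?_, ?_⟩
  · rintro ⟨j, _ | n, hn, hj⟩
    · exact absurd hj (Nat.succ_ne_zero _)
    · have hi : firstCoord n = i := by rw [← hrow, ← hj, Nat.add_sub_cancel, firstCoord_pairing]
      obtain ⟨k, hk⟩ := exists_pairing_eq n
      exact ⟨k, by rwa [← hi, hk]⟩
  · rintro ⟨j, hj⟩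
    have hpos := (Nat.succ_pos (pairing i j)).trans_le (strictMono_length_pairSeq v δ).le_apply
    obtain ⟨k, hk⟩ := exists_pairing_eq ((pairSeq v δ (pairing i j + 1)).1.length - 1)
    rw [hrow, firstCoord_pairing] at hk
    exact ⟨k, _, hj, by rw [hk, Nat.sub_add_cancel hpos]⟩

end Branches

section TestBranches

variable {E : Set (List Bool × List Bool)}

theorem IsTest.exists_append_mem (hE : IsTest E) {O : Set Cantor} (ho : IsOpen O) (hd : Dense O)
    (m : ℕ) {z : List Bool × List Bool} (hz : z ∈ generatedTree E) (h0 : z.1 ≠ []) :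
    ∃ v, (z.1 ++ v, z.2 ++ v) ∈ E ∧ firstCoord ((z.1 ++ v).length - 1) = m ∧
      cylinderOf (z.1 ++ v) ⊆ O ∧ cylinderOf (z.2 ++ v) ⊆ O := by
  obtain ⟨M, hM⟩ := exists_cylinderOf_append_subset ho hd z.1
  obtain ⟨N, hN⟩ := exists_cylinderOf_append_subset ho hd (z.2 ++ M)
  obtain ⟨h, -⟩ | ⟨y, hy, w, h1, h2⟩ := hz
  · exact absurd h h0
  obtain ⟨u, hu, hm⟩ := hE.extend m y hy (w ++ (M ++ N))
  have e1 : y.1 ++ false :: (w ++ (M ++ N) ++ u) = z.1 ++ (M ++ N ++ u) := by simp [h1]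
  have e2 : y.2 ++ true :: (w ++ (M ++ N) ++ u) = z.2 ++ (M ++ N ++ u) := by simp [h2]
  rw [e2] at hm
  rw [e1, e2] at hu
  refine ⟨M ++ N ++ u, hu, hE.length_eq _ hu ▸ hm, Subset.trans ?_ hM, Subset.trans ?_ hN⟩
  · rw [List.append_assoc, ← List.append_assoc]
    exact cylinderOf_append_subset _ _
  · rw [← List.append_assoc, ← List.append_assoc]
    exact cylinderOf_append_subset _ _

theorem IsTest.concat_mem_generatedTree (hE : IsTest E) {p : List Bool × List Bool} (hp : p ∈ E)
    {b : Bool} (hb : p.1 = [] → b = true) : (p.1 ++ [false], p.2 ++ [b]) ∈ generatedTree E := by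
  cases b with
  | true => exact append_mem_generatedTree hp []
  | false =>
    rcases hE.subset_generatedTree hp with ⟨h, -⟩ | ⟨y, hy, w, h1, h2⟩
    · exact absurd (hb h) (by decide)
    · exact Or.inr ⟨y, hy, w ++ [false], by simp [h1], by simp [h2]⟩

theorem IsTest.exists_extendPair_mem (hE : IsTest E) {O : Set Cantor} (ho : IsOpen O)
    (hd : Dense O) (m : ℕ) {p : List Bool × List Bool} (hp : p ∈ E) {b : Bool}
    (hb : p.1 = [] → b = true) :
    ∃ v, extendPair b v p ∈ E ∧ firstCoord ((extendPair b v p).1.length - 1) = m ∧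
      cylinderOf (extendPair b v p).1 ⊆ O ∧ cylinderOf (extendPair b v p).2 ⊆ O := by
  simpa only [List.append_assoc, List.singleton_append, extendPair] using
    hE.exists_append_mem ho hd m (hE.concat_mem_generatedTree hp hb) (by simp)

theorem IsTest.nil_mem (hE : IsTest E) : ([], []) ∈ E := by
  obtain ⟨⟨s, t⟩, ⟨hst, hs, ht⟩, -⟩ := hE.existsUnique 0
  obtain rfl := List.length_eq_zero_iff.1 hs
  obtain rfl := List.length_eq_zero_iff.1 ht
  exact hst

theorem IsTest.exists_pairSeq_mem (hE : IsTest E) {O : ℕ → Set Cantor} (ho : ∀ n, IsOpen (O n))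
    (hd : ∀ n, Dense (O n)) :
    ∃ v, ∀ δ : Cantor, δ 0 = true → ∀ n, pairSeq v δ n ∈ E ∧
      firstCoord ((pairSeq v δ (n + 1)).1.length - 1) = firstCoord n ∧
      cylinderOf (pairSeq v δ (n + 1)).1 ⊆ O n ∧ cylinderOf (pairSeq v δ (n + 1)).2 ⊆ O n := by
  choose! v hvE hvm hvO using fun n b p (hp : p ∈ E) hb =>
    hE.exists_extendPair_mem (ho n) (hd n) (firstCoord n) hp (b := b) hb
  refine ⟨v, fun δ hδ => ?_⟩
  have hnil : ∀ n, (pairSeq v δ n).1 = [] → δ n = true := fun n h => by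
    have := (strictMono_length_pairSeq v δ).le_apply (x := n)
    rw [h, List.length_nil, Nat.le_zero] at this
    rwa [this]
  have hmem : ∀ n, pairSeq v δ n ∈ E := fun n => by
    induction n with
    | zero => exact hE.nil_mem
    | succ n ih => exact hvE n _ _ ih (hnil n)
  exact fun n => ⟨hmem n, hvm n _ _ (hmem n) (hnil n), hvO n _ _ (hmem n) (hnil n)⟩

theorem IsTest.mem_branches_of_forall_exists (hE : IsTest E) {x : Cantor × Cantor}
    (h : ∀ n, ∃ p ∈ E, n ≤ p.1.length ∧ x.1 ∈ cylinderOf p.1 ∧ x.2 ∈ cylinderOf p.2) :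
    x ∈ branches (generatedTree E) := fun n => by
  obtain ⟨p, hp, hn, h1, h2⟩ := h n
  rw [initSeg_eq_take h1 hn, initSeg_eq_take h2 (hE.length_eq p hp ▸ hn)]
  exact hE.isBinaryPairTree.2 p (hE.subset_generatedTree hp) n

theorem IsTest.exists_continuous_branches (hE : IsTest E) {G : Set Cantor}
    (hG : G ∈ residual Cantor) :
    ∃ F : Cantor → Cantor × Cantor, Continuous F ∧ (∀ ε, F ε ∈ G ×ˢ G) ∧
      (∀ ε, F ε ∈ branches (generatedTree E)) ∧
      ∀ ε, rhoZero (shiftSeq (symmDiffSeq (F ε).1 (F ε).2)) = rhoZero ε := by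
  obtain ⟨O, ho, hd, hOG⟩ := exists_seq_isOpen_dense_iInter_subset hG
  obtain ⟨v, hv⟩ := hE.exists_pairSeq_mem ho hd
  let cons (ε : Cantor) : Cantor := fun n => n.casesOn true ε
  have hcons : Continuous cons := continuous_pi fun n => by
    cases n
    exacts [continuous_const, continuous_apply _]
  have hcyl (ε : Cantor) := pairLimit_mem_cylinderOf v (cons ε)
  have hlen (ε : Cantor) := strictMono_length_pairSeq v (cons ε)
  refine ⟨pairLimit v ∘ cons, (continuous_pairLimit v).comp hcons, fun ε => ?_, fun ε => ?_,
    fun ε => ?_⟩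
  · exact ⟨hOG (mem_iInter.2 fun n => (hv _ rfl n).2.2.1 (hcyl ε (n + 1)).1),
      hOG (mem_iInter.2 fun n => (hv _ rfl n).2.2.2 (hcyl ε (n + 1)).2)⟩
  · exact hE.mem_branches_of_forall_exists fun n => ⟨_, (hv _ rfl n).1, (hlen ε).le_apply, hcyl ε n⟩
  · exact rhoZero_shiftSeq_symmDiffSeq_pairLimit v (cons ε) fun n => (hv _ rfl n).2.1

end TestBranches

theorem continuous_shiftSeq_symmDiffSeq :
    Continuous fun x : Cantor × Cantor => shiftSeq (symmDiffSeq x.1 x.2) := by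
  refine continuous_shiftSeq.comp (continuous_pi fun m => ?_)
  have hcoord : Continuous fun x : Cantor × Cantor => (x.1 m, x.2 m) := by fun_prop
  exact (continuous_of_discreteTopology (f := fun b : Bool × Bool => xor b.1 b.2)).comp hcoord

theorem isPi0_branches_diff {T : Set (List Bool × List Bool)} {c : Ordinal.{0} → ℕ → Ordinal.{0}}
    (hc : IsLimitDecomposition c) {ξ : Ordinal.{0}} (hξ : ξ < Ordinal.omega 1) :
    IsPi0 (1 + ξ) (branches T \ setS c T ξ) := by
  have hcompl : (branches T \ setS c T ξ)ᶜ = (branches T)ᶜ ∪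
      (fun x : Cantor × Cantor => shiftSeq (symmDiffSeq x.1 x.2)) ⁻¹' (setH c ξ)ᶜ := by
    ext x
    simp only [setS, mem_compl_iff, mem_sdiff, mem_ofPred_eq, mem_union, mem_preimage]
    tauto
  rw [IsPi0, hcompl]
  exact ((IsSigma0.of_isOpen (isClosed_branches T).isOpen_compl).mono le_self_add).union
    ((hc.isSigma0_compl_setH hξ).preimage continuous_shiftSeq_symmDiffSeq)

theorem isSigma0_preimage_setS {T : Set (List Bool × List Bool)}
    {c : Ordinal.{0} → ℕ → Ordinal.{0}} (hc : IsLimitDecomposition c) {ξ : Ordinal.{0}}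
    (hξ : ξ < Ordinal.omega 1) :
    IsSigma0 (1 + ξ) (Subtype.val ⁻¹' setS c T ξ : Set ↥(branches T)) := by
  have hcompl : (Subtype.val ⁻¹' setS c T ξ : Set ↥(branches T)) =
      Subtype.val ⁻¹' (branches T \ setS c T ξ)ᶜ := by
    ext x
    simp
  rw [hcompl]
  exact (isPi0_branches_diff hc hξ).preimage continuous_subtype_val

theorem IsTest.isSigma0_of_isPotSigma0 {E : Set (List Bool × List Bool)} (hE : IsTest E)
    {ν : Ordinal.{0}} {A : Set (Cantor × Cantor)} (hA : IsPotSigma0 ν A) {H : Set Cantor}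
    (hH : ∀ y z, rhoZero y = rhoZero z → (y ∈ H ↔ z ∈ H))
    (hAH : ∀ x ∈ branches (generatedTree E), x ∈ A ↔ shiftSeq (symmDiffSeq x.1 x.2) ∈ H) :
    IsSigma0 ν H := by
  have : PolishSpace Cantor := by
    let := TopologicalSpace.metrizableSpaceMetric Cantor
    infer_instance
  obtain ⟨G, hG, G', hG', hGA⟩ := hA.exists_residual
  obtain ⟨F, hF, hFG, hFE, hFrho⟩ := hE.exists_continuous_branches (Filter.inter_mem hG hG')
  have hmem (ε : Cantor) : F ε ∈ G ×ˢ G' := ⟨(hFG ε).1.1, (hFG ε).2.2⟩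
  have hpre : H = (fun ε => (⟨F ε, hmem ε⟩ : ↥(G ×ˢ G'))) ⁻¹' (Subtype.val ⁻¹' A) := by
    ext ε
    exact (hH _ _ (hFrho ε)).symm.trans (hAH _ (hFE ε)).symm
  rw [hpre]
  exact hGA.preimage (hF.subtype_mk hmem)

theorem IsTest.not_isPotSigma0_branches_diff {E : Set (List Bool × List Bool)} (hE : IsTest E)
    {c : Ordinal.{0} → ℕ → Ordinal.{0}} (hc : IsLimitDecomposition c) {ξ : Ordinal.{0}}
    (hξ : ξ < Ordinal.omega 1) :
    ¬ IsPotSigma0 (1 + ξ) (branches (generatedTree E) \ setS c (generatedTree E) ξ) := fun hpot =>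
  hc.not_isSigma0_setH hξ <| hE.isSigma0_of_isPotSigma0 hpot (fun _ _ => hc.mem_setH_congr hξ)
    fun x hx => by simp [setS, hx]

theorem IsTest.not_isPotPi0_setS {E : Set (List Bool × List Bool)} (hE : IsTest E)
    {c : Ordinal.{0} → ℕ → Ordinal.{0}} (hc : IsLimitDecomposition c) {ξ : Ordinal.{0}}
    (hξ : ξ < Ordinal.omega 1) : ¬ IsPotPi0 (1 + ξ) (setS c (generatedTree E) ξ) := fun hpot =>
  have hpot' : IsPotSigma0 (1 + ξ) (setS c (generatedTree E) ξ)ᶜ := hpot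
  hc.not_isSigma0_setH hξ <| hE.isSigma0_of_isPotSigma0 hpot' (fun _ _ => hc.mem_setH_congr hξ)
    fun x hx => by simp [setS, hx]

theorem theorem1p11 :
    (∃ E : Set (List Bool × List Bool), IsTest E) ∧
    (∃ c : Ordinal.{0} → ℕ → Ordinal.{0}, IsLimitDecomposition c) ∧
    ∀ E : Set (List Bool × List Bool), IsTest E →
      IsTreeWithAcyclicLevels (generatedTree E) ∧
      ∀ c : Ordinal.{0} → ℕ → Ordinal.{0}, IsLimitDecomposition c →
      ∀ ξ : Ordinal.{0}, ξ < Ordinal.omega 1 →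
        IsSigma0 (1 + ξ)
          (Subtype.val ⁻¹' setS c (generatedTree E) ξ : Set ↥(branches (generatedTree E))) ∧
        IsPi0 (1 + ξ) (branches (generatedTree E) \ setS c (generatedTree E) ξ) ∧
        ¬ IsPotSigma0 (1 + ξ) (branches (generatedTree E) \ setS c (generatedTree E) ξ) ∧
        ¬ IsPotPi0 (1 + ξ) (setS c (generatedTree E) ξ) := by
  exact ⟨exists_isTest, exists_isLimitDecomposition, fun E hE =>
    ⟨hE.isTreeWithAcyclicLevels, fun c hc ξ hξ =>
      ⟨isSigma0_preimage_setS hc hξ, isPi0_branches_diff hc hξ,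
        hE.not_isPotSigma0_branches_diff hc hξ, hE.not_isPotPi0_setS hc hξ⟩⟩⟩
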